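/- **Notation.** Let $l_0\in\{0,\tfrac12,1,\dots\}$, $\rho,\sigma\in\mathbb R$, and let $\varphi^c=\varphi-i\epsilon$, $\theta^c=\theta-i\tau$, $\psi^c=\psi-i\varepsilon$ be complex Euler angles with $\varphi,\epsilon,\tau,\psi,\varepsilon$ real and $0\le\theta\le\pi$. Fix any function $z\mapsto\sqrt{\Gamma(z)}$ with $\sqrt{\Gamma(z)}^{\,2}=\Gamma(z)$; roots of products and quotients of Gamma functions with complex arguments mean the products and quotients of these values. *$\mathrm{SU}(2)$.* For $m,t\in\{-l_0,-l_0+1,\dots,l_0\}$, $P^{l_0}_{mt}(\cos\theta)$ is the $(m,t)$ matrix element of $\begin{pmatrix}\cos\frac\theta2&i\sin\frac\theta2\\ i\sin\frac\theta2&\cos\frac\theta2\end{pmatrix}$ in the representation $(T(g)f)(x)=(\beta x+\delta)^{2l_0}f\!\left(\frac{\alpha x+\gamma}{\beta x+\delta}\right)$, $g=\begin{pmatrix}\alpha&\beta\\ \gamma&\delta\end{pmatrix}$, on polynomials of degree at most $2l_0$, in the basis $x^{l_0-m}/\sqrt{(l_0-m)!\,(l_0+m)!}$. *$\mathrm{SU}(1,1)$.*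 For $l\in\mathbb C$ and $m,n\in l_0+\mathbb Z$, $\mathfrak P^{l}_{mn}(\cosh\tau)$ is the $(m,n)$ matrix element of $\begin{pmatrix}\cosh\frac\tau2&\sinh\frac\tau2\\ \sinh\frac\tau2&\cosh\frac\tau2\end{pmatrix}$ in the representation $(T(g)f)(z)=|D|^{2l+2l_0}D^{-2l_0}f\!\left(\frac{\alpha z+\bar\beta}{D}\right)$, $D=\beta z+\bar\alpha$, $g=\begin{pmatrix}\alpha&\beta\\ \bar\beta&\bar\alpha\end{pmatrix}$, on functions on the unit circle, in the basis $z^{-(n+l_0)}/\sqrt{\Gamma(l+n+1)\Gamma(l-n+1)}$. (As a function of $\tau\in\mathbb R$ it may change sign under $\tau\mapsto-\tau$.) Let $\mathbf F(a,b;c;x)=\sum_{s\ge0}\frac{(a)_s(b)_s}{\Gamma(c+s)\,s!}x^s$ be the regularized hypergeometric series; it equals ${}_2F_1(a,b;c;x)/\Gamma(c)$ unless $c\in\{0,-1,-2,\dots\}$. **Principal series.** Assume $\rho\ne0$ or $l_0\in\mathbb Z$, and let $m\in\{-l_0,\dots,l_0\}$, $n\in l_0+\mathbb Z$. All sums over $t$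 run over $t=-l_0,-l_0+1,\dots,l_0$. The relativistic spherical function of the principal series is $$\mathfrak M^{-\frac12+i\rho,l_0}_{mn}=e^{-im\varphi^c}Z^{-\frac12+i\rho,l_0}_{mn}(\cos\theta^c)\,e^{-in\psi^c},\qquad Z^{-\frac12+i\rho,l_0}_{mn}(\cos\theta^c)=\sum_{t}P^{l_0}_{mt}(\cos\theta)\,\mathfrak P^{-\frac12+i\rho}_{tn}(\cosh\tau).$$ Then $\mathfrak M^{-\frac12+i\rho,l_0}_{mn}=e^{-m(\epsilon+i\varphi)}Z^{-\frac12+i\rho,l_0}_{mn}(\cos\theta^c)\,e^{-n(\varepsilon+i\psi)}$, and for $\theta<\pi$ the function $Z=Z^{-\frac12+i\rho,l_0}_{mn}(\cos\theta^c)$ is given by each of the following expressions, in which the infinite series converge and, at $\theta=0$ or $\tau=0$, a product of powers of $\tan\frac\theta2$ or $\tanh\frac\tau2$ is read as its limit. (a) Series: $$\begin{aligned}Z=\sum_{t}\;&i^{m-t}\sqrt{\Gamma(l_0-m+1)\Gamma(l_0+m+1)\Gamma(l_0-t+1)\Gamma(l_0+t+1)}\,\cos^{2l_0}\tfrac\theta2\tan^{m-t}\tfrac\theta2\\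 &\times\sum_{j=\max(0,t-m)}^{\min(l_0-m,l_0+t)}\frac{i^{2j}\tan^{2j}\frac\theta2}{\Gamma(j+1)\Gamma(l_0-m-j+1)\Gamma(l_0+t-j+1)\Gamma(m-t+j+1)}\\ &\times\sqrt{\Gamma(\tfrac12+i\rho-n)\Gamma(\tfrac12+i\rho+n)\Gamma(\tfrac12+i\rho-t)\Gamma(\tfrac12+i\rho+t)}\,\cosh^{-1+2i\rho}\tfrac\tau2\tanh^{n-t}\tfrac\tau2\\ &\times\sum_{s=\max(0,t-n)}^{\infty}\frac{\tanh^{2s}\frac\tau2}{\Gamma(s+1)\Gamma(\frac12+i\rho-n-s)\Gamma(\frac12+i\rho+t-s)\Gamma(n-t+s+1)}.\end{aligned}$$ (b) Products of two hypergeometric functions (both formulas hold for all $m,n$, in particular the first for $m\ge n$ and the second for $n\ge m$): $$\begin{aligned}Z=\;&\sqrt{\tfrac{\Gamma(l_0+m+1)\,\Gamma(i\rho-n+\frac12)}{\Gamma(l_0-m+1)\,\Gamma(i\rho+n+\frac12)}}\cos^{2l_0}\tfrac\theta2\cosh^{-1+2i\rho}\tfrac\tau2\sum_t\sqrt{\tfrac{\Gamma(l_0-t+1)\,\Gamma(i\rho+t+\frac12)}{\Gamma(l_0+t+1)\,\Gamma(i\rho-t+\frac12)}}\;i^{m-t}\tan^{m-t}\tfrac\theta2\tanh^{t-n}\tfrac\tau2\\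 &\times\mathbf F(m-l_0,-t-l_0;m-t+1;-\tan^2\tfrac\theta2)\;\mathbf F(t-i\rho+\tfrac12,-n-i\rho+\tfrac12;t-n+1;\tanh^2\tfrac\tau2),\end{aligned}$$ $$\begin{aligned}Z=\;&\sqrt{\tfrac{\Gamma(l_0-m+1)\,\Gamma(i\rho+n+\frac12)}{\Gamma(l_0+m+1)\,\Gamma(i\rho-n+\frac12)}}\cos^{2l_0}\tfrac\theta2\cosh^{-1+2i\rho}\tfrac\tau2\sum_t\sqrt{\tfrac{\Gamma(l_0+t+1)\,\Gamma(i\rho-t+\frac12)}{\Gamma(l_0-t+1)\,\Gamma(i\rho+t+\frac12)}}\;i^{t-m}\tan^{t-m}\tfrac\theta2\tanh^{n-t}\tfrac\tau2\\ &\times\mathbf F(t-l_0,-m-l_0;t-m+1;-\tan^2\tfrac\theta2)\;\mathbf F(n-i\rho+\tfrac12,-t-i\rho+\tfrac12;n-t+1;\tanh^2\tfrac\tau2).\end{aligned}$$ (c) With ordinary ${}_2F_1$ only: writing $A=\max(m,t)$, $B=\min(m,t)$, $A'=\max(t,n)$, $B'=\min(t,n)$, $$\begin{aligned}Z=\;&\cos^{2l_0}\tfrac\theta2\cosh^{-1+2i\rho}\tfrac\tau2\sum_t\frac{i^{A-B}\tan^{A-B}\frac\theta2}{\Gamma(A-B+1)}\sqrt{\tfrac{\Gamma(l_0+A+1)\Gamma(l_0-B+1)}{\Gamma(l_0-A+1)\Gamma(l_0+B+1)}}\;{}_2F_1(A-l_0,-B-l_0;A-B+1;-\tan^2\tfrac\theta2)\\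 &\times\frac{\tanh^{A'-B'}\frac\tau2}{\Gamma(A'-B'+1)}\sqrt{\tfrac{\Gamma(i\rho+A'+\frac12)\Gamma(i\rho-B'+\frac12)}{\Gamma(i\rho-A'+\frac12)\Gamma(i\rho+B'+\frac12)}}\;{}_2F_1(A'-i\rho+\tfrac12,-B'-i\rho+\tfrac12;A'-B'+1;\tanh^2\tfrac\tau2).\end{aligned}$$ **Supplementary series.** Let $\sigma\notin\tfrac12+\mathbb Z$ and $m,n\in\mathbb Z$ (with $l_0=0$ in the definition of $\mathfrak P$). The relativistic spherical function of the supplementary series is $\mathfrak M^{-\frac12-\sigma}_{mn}=e^{-im\varphi^c}\,\mathfrak P^{-\frac12-\sigma}_{mn}(\cosh\tau)\,e^{-in\psi^c}=e^{-m(\epsilon+i\varphi)}\,\mathfrak P^{-\frac12-\sigma}_{mn}(\cosh\tau)\,e^{-n(\varepsilon+i\psi)}$. For $l_0=0$ and $\rho=i\sigma$ (so that $m=0$) the principal-series expressions reduce to it: $Z^{-\frac12+i\rho,0}_{0n}(\cos\theta^c)=\mathfrak P^{-\frac12-\sigma}_{0n}(\cosh\tau)$ and $\mathfrak M^{-\frac12+i\rho,0}_{0n}=\mathfrak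 M^{-\frac12-\sigma}_{0n}$. For all $m,n\in\mathbb Z$, $$\begin{aligned}\mathfrak P^{-\frac12-\sigma}_{mn}(\cosh\tau)=\;&\sqrt{\Gamma(\tfrac12-\sigma-n)\Gamma(\tfrac12-\sigma+n)\Gamma(\tfrac12-\sigma-m)\Gamma(\tfrac12-\sigma+m)}\,\cosh^{-1-2\sigma}\tfrac\tau2\tanh^{n-m}\tfrac\tau2\\ &\times\sum_{s=\max(0,m-n)}^{\infty}\frac{\tanh^{2s}\frac\tau2}{\Gamma(s+1)\Gamma(\frac12-\sigma-n-s)\Gamma(\frac12-\sigma+m-s)\Gamma(n-m+s+1)},\end{aligned}$$ with a convergent series, and for $m\ge n$ $$\mathfrak P^{-\frac12-\sigma}_{mn}(\cosh\tau)=\sqrt{\tfrac{\Gamma(m-\sigma+\frac12)\Gamma(-n-\sigma+\frac12)}{\Gamma(-m-\sigma+\frac12)\Gamma(n-\sigma+\frac12)}}\;\frac{\cosh^{-1-2\sigma}\frac\tau2\tanh^{m-n}\frac\tau2}{\Gamma(m-n+1)}\;{}_2F_1(m+\sigma+\tfrac12,-n+\sigma+\tfrac12;m-n+1;\tanh^2\tfrac\tau2),$$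 while for $n\ge m$ the same holds with $m$ and $n$ interchanged on the right-hand side. -/

import Mathlib

namespace LorentzSpherical

/-- `r` is a choice of the complex square root `z ↦ √Γ(z)`. Every root of a product or of a
quotient of Gamma functions with complex arguments is the corresponding product or quotient of
values of `r`. (At a pole of `Γ`, where Mathlib has `Γ = 0`, the value is irrelevant.) -/
def IsSqrtGamma (r : ℂ → ℂ) : Prop := ∀ z : ℂ, r z ^ 2 = Complex.Gamma z

/-! ### Representations of `SU(2)`

The spin is `l₀ = L / 2`, and the weights are numbered as `i - L / 2`, `i = 0, …, L`. -/

/-- The representation of spin `L / 2` on polynomials of degree at most `L`: for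
`g = !![α, β; γ, δ]`, `(T g f) x = (β x + δ) ^ L * f ((α x + γ) / (β x + δ))`. -/
noncomputable def su2Op (L : ℕ) (g : Matrix (Fin 2) (Fin 2) ℂ) (f : Polynomial ℂ) :
    Polynomial ℂ :=
  f.sum fun q c => Polynomial.C c
    * (Polynomial.C (g 0 0) * Polynomial.X + Polynomial.C (g 1 0)) ^ q
    * (Polynomial.C (g 0 1) * Polynomial.X + Polynomial.C (g 1 1)) ^ (L - q)

/-- The constant `√((l₀ + m)! (l₀ - m)!)` for the weight `m = i - L / 2`, `l₀ = L / 2`. -/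
noncomputable def su2Norm (L i : ℕ) : ℝ := Real.sqrt (i.factorial * (L - i).factorial)

/-- The orthonormal basis vector `x ^ (l₀ - m) / √((l₀ + m)! (l₀ - m)!)` of weight
`m = i - L / 2`. -/
noncomputable def su2Basis (L i : ℕ) : Polynomial ℂ :=
  Polynomial.C ((su2Norm L i : ℂ)⁻¹) * Polynomial.X ^ (L - i)

/-- The matrix element of `T g` with row weight `i - L / 2` and column weight `k - L / 2`:
the coordinate of `T g (su2Basis L k)` along `su2Basis L i`. -/
noncomputable def su2MatrixElement (L : ℕ) (g : Matrix (Fin 2) (Fin 2) ℂ) (i k : ℕ) : ℂ :=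
  (su2Norm L i : ℂ) * (su2Op L g (su2Basis L k)).coeff (L - i)

/-- The rotation with Euler angles `(0, θ, 0)`. -/
noncomputable def rotation (θ : ℝ) : Matrix (Fin 2) (Fin 2) ℂ :=
  !![(Real.cos (θ / 2) : ℂ), Complex.I * (Real.sin (θ / 2) : ℂ);
     Complex.I * (Real.sin (θ / 2) : ℂ), (Real.cos (θ / 2) : ℂ)]

/-- The generalized spherical function `P^{l₀}_{mn}(cos θ)`, `0 ≤ θ ≤ π`, with `l₀ = L / 2`,
`m = i - L / 2`, `n = k - L / 2`. -/
noncomputable def sphericalP (L i k : ℕ) (θ : ℝ) : ℂ := su2MatrixElement L (rotation θ) i k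

/-! ### Representations of `SU(1,1)`

The weights of a representation of type `e` are the numbers `i + e / 2`, `i ∈ ℤ`. -/

/-- The representation of `SU(1,1)` with label `l` and type `e` on functions on the unit circle:
for `g = !![α, β; conj β, conj α]` and `D = β z + conj α`,
`(T g f) z = |D| ^ (2 l - e) * D ^ e * f ((α z + conj β) / D)`. -/
noncomputable def su11Op (l : ℂ) (e : ℤ) (g : Matrix (Fin 2) (Fin 2) ℂ) (f : ℂ → ℂ) : ℂ → ℂ :=
  fun z => (‖g 0 1 * z + g 1 1‖ : ℂ) ^ (2 * l - (e : ℂ)) * (g 0 1 * z + g 1 1) ^ e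
    * f ((g 0 0 * z + g 1 0) / (g 0 1 * z + g 1 1))

/-- The constant `√(Γ(l + w + 1) Γ(l - w + 1))`. For `Re l = -1/2` its modulus does not depend on
the weight `w`, so that rescaling `z ↦ z ^ (-k)` by it only changes phases. -/
noncomputable def su11Norm (r : ℂ → ℂ) (l : ℂ) (w : ℂ) : ℂ := r (l + w + 1) * r (l - w + 1)

/-- The basis function `z ^ (-k) / √(Γ(l + w + 1) Γ(l - w + 1))` of weight `w = k + e / 2`. -/
noncomputable def su11Basis (r : ℂ → ℂ) (l : ℂ) (e k : ℤ) : ℂ → ℂ :=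
  fun z => (su11Norm r l ((k : ℂ) + (e : ℂ) / 2))⁻¹ * z ^ (-k)

/-- The matrix element of `T g` with row weight `i + e / 2` and column weight `k + e / 2`: the
Fourier coordinate of `T g (su11Basis r l e k)` along `su11Basis r l e i`. -/
noncomputable def su11MatrixElement (r : ℂ → ℂ) (l : ℂ) (e : ℤ) (g : Matrix (Fin 2) (Fin 2) ℂ)
    (i k : ℤ) : ℂ :=
  su11Norm r l ((i : ℂ) + (e : ℂ) / 2) *
    ((2 * (Real.pi : ℂ))⁻¹ * ∫ x in (0 : ℝ)..(2 * Real.pi),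
      su11Op l e g (su11Basis r l e k) (Complex.exp (Complex.I * (x : ℂ)))
        * Complex.exp (Complex.I * (x : ℂ)) ^ i)

/-- The element of `SU(1,1)` with Euler parameters `(0, τ, 0)`. -/
noncomputable def boost (τ : ℝ) : Matrix (Fin 2) (Fin 2) ℂ :=
  !![(Real.cosh (τ / 2) : ℂ), (Real.sinh (τ / 2) : ℂ);
     (Real.sinh (τ / 2) : ℂ), (Real.cosh (τ / 2) : ℂ)]

/-- The Jacobi function `𝔓^l_{mn}(cosh τ)`, with `m = i + e / 2`, `n = k + e / 2`. -/
noncomputable def jacobiP (r : ℂ → ℂ) (l : ℂ) (e i k : ℤ) (τ : ℝ) : ℂ :=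
  su11MatrixElement r l e (boost τ) i k

/-! ### Relativistic spherical functions

The complex Euler angles are `φᶜ = φ - i ε`, `θᶜ = θ - i τ`, `ψᶜ = ψ - i ε'`. -/

/-- `Z^{-1/2 + iρ, l₀}_{mn}(cos θᶜ) = ∑ t, P^{l₀}_{mt}(cos θ) 𝔓^{-1/2 + iρ}_{tn}(cosh τ)`, with
`θᶜ = θ - i τ`, `l₀ = L / 2`, `m = i - l₀`, `n = k - l₀` and `t = p - l₀` running over
`-l₀, -l₀ + 1, …, l₀`. -/
noncomputable def principalZ (r : ℂ → ℂ) (ρ : ℂ) (L i : ℕ) (k : ℤ) (θc : ℂ) : ℂ :=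
  ∑ p ∈ Finset.range (L + 1),
    sphericalP L i p θc.re * jacobiP r (-1 / 2 + Complex.I * ρ) (-(L : ℤ)) (p : ℤ) k (-θc.im)

/-- The relativistic spherical function of the principal series,
`exp (-i m φᶜ) Z_{mn}(cos θᶜ) exp (-i n ψᶜ)`, with `m = i - L / 2`, `n = k - L / 2`. -/
noncomputable def principalSpherical (r : ℂ → ℂ) (ρ : ℂ) (L i : ℕ) (k : ℤ) (φc θc ψc : ℂ) : ℂ :=
  Complex.exp (-Complex.I * ((i : ℂ) - (L : ℂ) / 2) * φc) * principalZ r ρ L i k θc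
    * Complex.exp (-Complex.I * ((k : ℂ) - (L : ℂ) / 2) * ψc)

/-- The relativistic spherical function of the supplementary series,
`exp (-i m φᶜ) 𝔓^{-1/2 - σ}_{mn}(cosh τ) exp (-i n ψᶜ)`, `m, n ∈ ℤ`. -/
noncomputable def supplementarySpherical (r : ℂ → ℂ) (σ : ℝ) (m n : ℤ) (φc θc ψc : ℂ) : ℂ :=
  Complex.exp (-Complex.I * (m : ℂ) * φc) * jacobiP r (-1 / 2 - (σ : ℂ)) 0 m n (-θc.im)
    * Complex.exp (-Complex.I * (n : ℂ) * ψc)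

/-! ### Hypergeometric functions -/

/-- The regularized hypergeometric series `∑ s, (a)_s (b)_s / (Γ(c + s) s!) x ^ s`, which is
`₂F₁(a, b; c; x) / Γ(c)` and remains defined when `c` is a nonpositive integer (the reciprocal of
`Γ` at a pole is `0`). -/
noncomputable def regularized2F1 (a b c x : ℂ) : ℂ :=
  ∑' s : ℕ, (ascPochhammer ℂ s).eval a * (ascPochhammer ℂ s).eval b
    / (Complex.Gamma (c + (s : ℂ)) * (s.factorial : ℂ)) * x ^ s

end LorentzSpherical

/-!
Both kinds of matrix elements are values of one bilateral series
`∑ q, x ^ (d + 2 q) / (Γ(q + 1) Γ(u - q) Γ(v - q) Γ(d + q + 1))` (`matrixSeries`), where the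
reciprocals of `Γ` at its poles cut the summation down to `q ≥ max 0 (-d)`.

* For a rotation, `x = i tan (θ / 2)`; expanding the two powers of linear polynomials in `su2Op` by
  the binomial theorem gives `sphericalP_eq_matrixSeries`.
* For a boost, `x = tanh (τ / 2)`. On the unit circle `su11Op` turns a basis function into a constant
  times `(1 + x z) ^ (l + w) (1 + x / z) ^ (l - w)` times a power of `z`. Both factors have absolutely
  convergent binomial series, as `|x| < 1`, and `hasSum_jacobiP` reads off the Fourier coefficient of
  the product.

The substitution `q ↦ q + d` exchanges the two weights (`matrixSeries_swap`), so both matrix elements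
are symmetric. Reflection for rising factorials turns the series into a regularized hypergeometric
function (`matrixSeries_eq_regularized2F1`), which for `d ≥ 0` is an ordinary one. Hence every
expression for `Z` holds term by term in `t`: the first product formula and the second one differ
by the symmetry, and the formula with ordinary hypergeometric functions uses, in each factor, the
order of the two weights that makes `d ≥ 0`.
-/

namespace LorentzSpherical

/-! ### The bilateral series behind the matrix elements -/

/-- The term `x ^ (d + 2 q) / (Γ(q + 1) Γ(u - q) Γ(v - q) Γ(d + q + 1))`. It vanishes unless
`q ≥ 0` and `d + q ≥ 0`, because Mathlib's `Γ` is `0` at its poles; hence the value `0` of a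
negative power of `x = 0` does no harm. -/
noncomputable def matrixTerm (d : ℤ) (u v x : ℂ) (q : ℤ) : ℂ :=
  x ^ (d + 2 * q) * ((Complex.Gamma (q + 1))⁻¹ * (Complex.Gamma (u - q))⁻¹
    * (Complex.Gamma (v - q))⁻¹ * (Complex.Gamma (d + q + 1))⁻¹)

/-- The sum of `matrixTerm d u v x q` over all integers `q`. -/
noncomputable def matrixSeries (d : ℤ) (u v x : ℂ) : ℂ := ∑' q : ℤ, matrixTerm d u v x q

theorem Gamma_intCast_add_one_of_neg {q : ℤ} (hq : q < 0) : Complex.Gamma ((q : ℂ) + 1) = 0 := by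
  rw [Complex.Gamma_eq_zero_iff]
  refine ⟨(-q - 1).toNat, ?_⟩
  have h : (((-q - 1).toNat : ℤ) : ℂ) = ((-q - 1 : ℤ) : ℂ) := by
    rw [Int.toNat_of_nonneg (by omega)]
  have h' : (((-q - 1).toNat : ℕ) : ℂ) = -(q : ℂ) - 1 := by
    have := h
    push_cast at this
    exact_mod_cast this
  rw [h']; ring

theorem matrixTerm_of_neg {d q : ℤ} (u v x : ℂ) (hq : q < 0) : matrixTerm d u v x q = 0 := by
  simp [matrixTerm, Gamma_intCast_add_one_of_neg hq]

theorem matrixTerm_of_add_neg {d q : ℤ} (u v x : ℂ) (hq : d + q < 0) :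
    matrixTerm d u v x q = 0 := by
  have := Gamma_intCast_add_one_of_neg hq
  push_cast at this
  simp [matrixTerm, this]

/-- The powers of `x` may be split off, also at `x = 0`. -/
theorem matrixTerm_eq_zpow_mul (d : ℤ) (u v x : ℂ) (q : ℕ) :
    matrixTerm d u v x q = x ^ d * (x ^ (2 * q) * ((Complex.Gamma (q + 1))⁻¹
      * (Complex.Gamma (u - q))⁻¹ * (Complex.Gamma (v - q))⁻¹
      * (Complex.Gamma (d + q + 1))⁻¹)) := by
  by_cases hx : x = 0
  · by_cases hq : d + q < 0
    · have := Gamma_intCast_add_one_of_neg hq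
      push_cast at this
      rw [matrixTerm_of_add_neg u v x hq, this]
      simp
    · subst hx
      rcases Nat.eq_zero_or_pos q with rfl | hq0
      · simp [matrixTerm]
      · rw [matrixTerm, zero_zpow _ (by omega), zero_pow (by omega)]
        simp
  · rw [matrixTerm, zpow_add₀ hx, ← mul_assoc (x ^ d)]
    norm_cast

/-- Exchanging the two weights of a matrix element, that is, the substitution `q ↦ q + d`. -/
theorem matrixSeries_swap (d : ℤ) (u v x : ℂ) :
    matrixSeries d u v x = matrixSeries (-d) (u + d) (v + d) x := by
  unfold matrixSeries
  rw [← (Equiv.addRight d).tsum_eq (matrixTerm (-d) (u + d) (v + d) x)]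
  refine tsum_congr fun q => ?_
  simp only [matrixTerm, Equiv.coe_addRight]
  push_cast
  rw [show -d + 2 * (q + d) = d + 2 * q by ring, show u + d - (q + d : ℂ) = u - q by ring,
    show v + d - (q + d : ℂ) = v - q by ring, show -(d : ℂ) + (q + d) + 1 = q + 1 by ring,
    show (q : ℂ) + d + 1 = d + q + 1 by ring]
  ring

theorem matrixSeries_eq_tsum_nat (d : ℤ) (u v x : ℂ) :
    matrixSeries d u v x = ∑' q : ℕ, matrixTerm d u v x q := by
  refine ((Nat.cast_injective (R := ℤ)).tsum_eq ?_).symm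
  intro q hq
  by_contra h
  refine hq (matrixTerm_of_neg u v x ?_)
  by_contra h'
  exact h ⟨q.toNat, Int.toNat_of_nonneg (by omega)⟩

/-- Reflection for rising factorials, `(1 - u)_n / Γ(u) = (-1) ^ n / Γ(u - n)`, valid for all `u`
because `1 / Γ` is entire. -/
theorem ascPochhammer_eval_mul_inv_Gamma (u : ℂ) (n : ℕ) :
    (ascPochhammer ℂ n).eval (1 - u) * (Complex.Gamma u)⁻¹
      = (-1) ^ n * (Complex.Gamma (u - n))⁻¹ := by
  induction n with
  | zero => simp
  | succ n ih =>
    rw [ascPochhammer_succ_eval, mul_right_comm, ih,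
      Complex.one_div_Gamma_eq_self_mul_one_div_Gamma_add_one (u - (n + 1 : ℕ))]
    push_cast
    rw [show u - ((n : ℂ) + 1) + 1 = u - n by ring]
    ring

theorem matrixSeries_eq_regularized2F1 (d : ℤ) (u v x : ℂ) :
    matrixSeries d u v x = (Complex.Gamma u)⁻¹ * (Complex.Gamma v)⁻¹ * x ^ d
      * regularized2F1 (1 - u) (1 - v) (d + 1) (x ^ 2) := by
  rw [matrixSeries_eq_tsum_nat, regularized2F1, ← tsum_mul_left]
  refine tsum_congr fun q => ?_
  have hu := ascPochhammer_eval_mul_inv_Gamma u q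
  have hv := ascPochhammer_eval_mul_inv_Gamma v q
  have h1 : ((-1 : ℂ) ^ q) * (-1) ^ q = 1 := by rw [← mul_pow]; simp
  rw [matrixTerm_eq_zpow_mul, Complex.Gamma_nat_eq_factorial, div_eq_mul_inv, mul_inv,
    show (d : ℂ) + 1 + q = d + q + 1 by ring, pow_mul]
  calc _ = ((-1 : ℂ) ^ q * (-1) ^ q) * (x ^ d * ((x ^ 2) ^ q * (((q.factorial : ℂ))⁻¹
      * (Complex.Gamma (u - q))⁻¹ * (Complex.Gamma (v - q))⁻¹
      * (Complex.Gamma (d + q + 1))⁻¹))) := by rw [h1, one_mul]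
    _ = ((-1 : ℂ) ^ q * (Complex.Gamma (u - q))⁻¹) * ((-1 : ℂ) ^ q * (Complex.Gamma (v - q))⁻¹)
      * (x ^ d * ((x ^ 2) ^ q * (((q.factorial : ℂ))⁻¹ * (Complex.Gamma (d + q + 1))⁻¹))) := by
        ring
    _ = _ := by rw [← hu, ← hv]; ring

theorem regularized2F1_natCast_add_one (a b x : ℂ) (d : ℕ) :
    regularized2F1 a b (d + 1) x
      = (Complex.Gamma (d + 1))⁻¹ * ordinaryHypergeometric a b ((d : ℂ) + 1) x := by
  have hΓ : ∀ s : ℕ, Complex.Gamma ((d : ℂ) + 1 + s)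
      = Complex.Gamma (d + 1) * (ascPochhammer ℂ s).eval ((d : ℂ) + 1) := by
    intro s
    induction s with
    | zero => simp
    | succ s ih =>
      rw [ascPochhammer_succ_eval, ← mul_assoc, ← ih]
      push_cast
      rw [← add_assoc, Complex.Gamma_add_one _ (by norm_cast; omega), mul_comm]
  rw [ordinaryHypergeometric_eq_tsum, regularized2F1, ← tsum_mul_left]
  refine tsum_congr fun s => ?_
  rw [hΓ, smul_eq_mul, div_eq_mul_inv, mul_inv, mul_inv]
  ring

/-- The sum over the integers `s ≥ max 0 (-d)`, with the power of `x` split off. -/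
theorem matrixSeries_eq_tsum_Ici (d : ℤ) (u v x : ℂ) :
    matrixSeries d u v x = x ^ d * ∑' s : Set.Ici (-d).toNat,
      x ^ (2 * (s : ℕ)) / (Complex.Gamma ((s : ℕ) + 1) * Complex.Gamma (u - (s : ℕ))
        * Complex.Gamma (v - (s : ℕ)) * Complex.Gamma (d + (s : ℕ) + 1)) := by
  rw [matrixSeries_eq_tsum_nat, ← tsum_mul_left]
  rw [← Function.Injective.tsum_eq (g := ((↑) : Set.Ici (-d).toNat → ℕ))
    Subtype.coe_injective]
  · refine tsum_congr fun s => ?_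
    rw [matrixTerm_eq_zpow_mul, div_eq_mul_inv, mul_inv, mul_inv, mul_inv]
  · intro q hq
    rw [Subtype.range_coe]
    by_contra h
    refine hq (matrixTerm_of_add_neg u v x ?_)
    simp only [Set.mem_Ici, not_le] at h
    omega

/-- Summability passes from the full terms to the terms without the power `x ^ d`. At `x = 0` at
most one term of the latter series is nonzero. -/
theorem summable_Ici_of_summable_matrixTerm {d : ℤ} {u v x : ℂ}
    (h : Summable (matrixTerm d u v x)) :
    Summable fun s : Set.Ici (-d).toNat =>
      x ^ (2 * (s : ℕ)) / (Complex.Gamma ((s : ℕ) + 1) * Complex.Gamma (u - (s : ℕ))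
        * Complex.Gamma (v - (s : ℕ)) * Complex.Gamma (d + (s : ℕ) + 1)) := by
  suffices hs : Summable fun s : ℕ =>
      x ^ (2 * s) / (Complex.Gamma (s + 1) * Complex.Gamma (u - s)
        * Complex.Gamma (v - s) * Complex.Gamma (d + s + 1)) from
    hs.comp_injective Subtype.coe_injective
  by_cases hx : x = 0
  · refine summable_of_ne_finset_zero (s := {0}) fun s hs => ?_
    rw [hx, zero_pow (by simpa using hs), zero_div]
  · have h' := (h.comp_injective (Nat.cast_injective (R := ℤ))).mul_left (x ^ d)⁻¹
    refine h'.congr fun s => ?_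
    rw [Function.comp_apply, matrixTerm_eq_zpow_mul, inv_mul_cancel_left₀ (zpow_ne_zero _ hx),
      div_eq_mul_inv, mul_inv, mul_inv, mul_inv]

/-! ### Matrix elements of the rotations -/

theorem coeff_C_mul_X_add_C_pow (a b : ℂ) (n k : ℕ) :
    ((Polynomial.C a * Polynomial.X + Polynomial.C b) ^ n).coeff k
      = b ^ (n - k) * n.choose k * a ^ k := by
  have h : (Polynomial.C a * Polynomial.X + Polynomial.C b) ^ n
      = ((Polynomial.X + Polynomial.C b) ^ n).comp (Polynomial.C a * Polynomial.X) := by simp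
  rw [h, Polynomial.comp_C_mul_X_coeff, Polynomial.coeff_X_add_C_pow]

theorem su2Norm_sq (L i : ℕ) : (su2Norm L i : ℂ) ^ 2 = i.factorial * (L - i).factorial := by
  rw [su2Norm, ← Complex.ofReal_pow, Real.sq_sqrt (by positivity)]
  push_cast
  rfl

theorem su2Norm_ne_zero (L i : ℕ) : (su2Norm L i : ℂ) ≠ 0 := by
  have : 0 < su2Norm L i := Real.sqrt_pos.2 (by positivity)
  exact_mod_cast this.ne'

theorem su2MatrixElement_eq_sum (L i p : ℕ) (hp : p ≤ L) (g : Matrix (Fin 2) (Fin 2) ℂ) :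
    su2MatrixElement L g i p = (su2Norm L i : ℂ) * (su2Norm L p : ℂ)⁻¹
      * ∑ q ∈ Finset.range (L - i + 1),
        (g 1 0 ^ (L - p - (L - i - q)) * (L - p).choose (L - i - q) * g 0 0 ^ (L - i - q))
          * (g 1 1 ^ (p - q) * p.choose q * g 0 1 ^ q) := by
  rw [su2MatrixElement, su2Op, su2Basis, Polynomial.C_mul_X_pow_eq_monomial,
    Polynomial.sum_monomial_index _ _ (by simp), mul_assoc (Polynomial.C _),
    Polynomial.coeff_C_mul, Nat.sub_sub_self hp, Polynomial.coeff_mul,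
    ← Finset.Nat.sum_antidiagonal_swap, Finset.Nat.sum_antidiagonal_eq_sum_range_succ_mk,
    ← mul_assoc]
  simp only [coeff_C_mul_X_add_C_pow, Prod.swap, Nat.succ_eq_add_one]

theorem Gamma_natCast_add_one_sub_of_le {n q : ℕ} (h : q ≤ n) :
    Complex.Gamma ((n : ℂ) + 1 - q) = (n - q).factorial := by
  rw [← Complex.Gamma_nat_eq_factorial, Nat.cast_sub h]
  ring_nf

theorem Gamma_natCast_add_one_sub_of_lt {n q : ℕ} (h : n < q) :
    Complex.Gamma ((n : ℂ) + 1 - q) = 0 := by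
  have := Gamma_intCast_add_one_of_neg (q := (n : ℤ) - q) (by omega)
  push_cast at this
  rw [← this]
  ring_nf

theorem matrixSeries_natCast_eq_sum (d : ℤ) (n : ℕ) (v x : ℂ) :
    matrixSeries d (n + 1) v x = ∑ q ∈ Finset.range (n + 1), matrixTerm d (n + 1) v x q := by
  rw [matrixSeries_eq_tsum_nat, tsum_eq_sum]
  intro q hq
  rw [Finset.mem_range, not_lt] at hq
  have : Complex.Gamma ((n : ℂ) + 1 - q) = 0 := Gamma_natCast_add_one_sub_of_lt (by omega)
  simp [matrixTerm, this]

theorem sphericalP_eq_matrixSeries (L i p : ℕ) (hi : i ≤ L) (hp : p ≤ L) (θ : ℝ)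
    (hc : Real.cos (θ / 2) ≠ 0) :
    sphericalP L i p θ = (su2Norm L i : ℂ) * su2Norm L p * (Real.cos (θ / 2) : ℂ) ^ L
      * matrixSeries ((i : ℤ) - p) ((L - i : ℕ) + 1) (p + 1)
        (Complex.I * (Real.tan (θ / 2) : ℂ)) := by
  have hc' : (Real.cos (θ / 2) : ℂ) ≠ 0 := by exact_mod_cast hc
  rw [sphericalP, su2MatrixElement_eq_sum L i p hp, matrixSeries_natCast_eq_sum]
  simp only [rotation, Matrix.of_apply, Matrix.cons_val', Matrix.cons_val_zero,
    Matrix.cons_val_one, Matrix.cons_val_fin_one]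
  have hs : Complex.I * (Real.sin (θ / 2) : ℂ)
      = Real.cos (θ / 2) * (Complex.I * (Real.tan (θ / 2) : ℂ)) := by
    rw [Real.tan_eq_sin_div_cos, Complex.ofReal_div]
    field_simp
  rw [hs]
  set c : ℂ := (Real.cos (θ / 2) : ℂ)
  set x : ℂ := Complex.I * (Real.tan (θ / 2) : ℂ)
  have hN : (su2Norm L p : ℂ)⁻¹ * (p.factorial * (L - p).factorial) = su2Norm L p := by
    rw [← su2Norm_sq, sq, inv_mul_cancel_left₀ (su2Norm_ne_zero L p)]
  suffices h : (∑ q ∈ Finset.range (L - i + 1),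
      ((c * x) ^ (L - p - (L - i - q)) * (L - p).choose (L - i - q) * c ^ (L - i - q))
        * (c ^ (p - q) * p.choose q * (c * x) ^ q)) = (p.factorial * (L - p).factorial) * (c ^ L
      * ∑ q ∈ Finset.range (L - i + 1),
        matrixTerm ((i : ℤ) - p) ((L - i : ℕ) + 1) (p + 1) x q) by
    rw [h]
    nth_rewrite 2 [← hN]
    ring
  rw [Finset.mul_sum, Finset.mul_sum]
  refine Finset.sum_congr rfl fun q hq => ?_
  rw [Finset.mem_range] at hq
  by_cases hqp : p < q
  · simp [matrixTerm, Gamma_natCast_add_one_sub_of_lt hqp, Nat.choose_eq_zero_of_lt hqp]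
  by_cases hqi : i + q < p
  · rw [matrixTerm_of_add_neg _ _ _ (by omega),
      Nat.choose_eq_zero_of_lt (show L - p < L - i - q by omega)]
    simp
  have hg : Complex.Gamma (((i : ℤ) - p : ℤ) + (q : ℤ) + 1) = (i + q - p).factorial := by
    rw [← Complex.Gamma_nat_eq_factorial, Nat.cast_sub (by omega)]
    push_cast
    ring_nf
  have hx : x ^ ((i : ℤ) - p + 2 * (q : ℤ)) = x ^ (i + q - p) * x ^ q := by
    rw [← pow_add, ← zpow_natCast]
    congr 1
    omega
  have e1 : L - p - (L - i - q) = i + q - p := by omega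
  have e2 : c ^ L = c ^ (i + q - p) * c ^ (L - i - q) * c ^ (p - q) * c ^ q := by
    rw [← pow_add, ← pow_add, ← pow_add]
    congr 1
    omega
  have f1 : ((L - p).choose (L - i - q) : ℂ)
      = (L - p).factorial * ((L - i - q).factorial : ℂ)⁻¹ * ((i + q - p).factorial : ℂ)⁻¹ := by
    rw [Nat.cast_choose ℂ (by omega), e1, div_eq_mul_inv, mul_inv, mul_assoc]
  have f2 : (p.choose q : ℂ) = p.factorial * (q.factorial : ℂ)⁻¹ * ((p - q).factorial : ℂ)⁻¹ := by
    rw [Nat.cast_choose ℂ (by omega), div_eq_mul_inv, mul_inv, mul_assoc]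
  rw [matrixTerm, hx, hg, Int.cast_natCast, Complex.Gamma_nat_eq_factorial,
    Gamma_natCast_add_one_sub_of_le (by omega), Gamma_natCast_add_one_sub_of_le (by omega),
    e1, e2, f1, f2, mul_pow, mul_pow]
  ring

/-- The finite form of the series for natural parameters. -/
theorem matrixSeries_natCast_eq_sum_Icc (d : ℤ) (n p : ℕ) (x : ℂ) :
    matrixSeries d (n + 1) (p + 1) x = x ^ d * ∑ j ∈ Finset.Icc (max 0 (-d)) (min (n : ℤ) p),
      x ^ (2 * j) / (Complex.Gamma (j + 1) * Complex.Gamma (n + 1 - j)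
        * Complex.Gamma (p + 1 - j) * Complex.Gamma (d + j + 1)) := by
  rw [matrixSeries, tsum_eq_sum (s := Finset.Icc (max 0 (-d)) (min (n : ℤ) p)), Finset.mul_sum]
  · refine Finset.sum_congr rfl fun j hj => ?_
    rw [Finset.mem_Icc] at hj
    obtain ⟨q, rfl⟩ : ∃ q : ℕ, j = q := ⟨j.toNat, by omega⟩
    rw [matrixTerm_eq_zpow_mul, div_eq_mul_inv, mul_inv, mul_inv, mul_inv]
    norm_cast
  · intro j hj
    rw [Finset.mem_Icc] at hj
    by_cases h0 : j < 0
    · exact matrixTerm_of_neg _ _ _ h0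
    by_cases h1 : d + j < 0
    · exact matrixTerm_of_add_neg _ _ _ h1
    obtain ⟨q, rfl⟩ : ∃ q : ℕ, j = q := ⟨j.toNat, by omega⟩
    rw [matrixTerm, Int.cast_natCast]
    rcases (by omega : n < q ∨ p < q) with h | h <;>
      simp [Gamma_natCast_add_one_sub_of_lt h]

/-! ### Matrix elements of the boosts -/

theorem ring_choose_eq_Gamma {a : ℂ} (ha : Complex.Gamma (a + 1) ≠ 0) (n : ℕ) :
    Ring.choose a n = Complex.Gamma (a + 1) * ((Complex.Gamma (n + 1))⁻¹
      * (Complex.Gamma (a + 1 - n))⁻¹) := by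
  have h := ascPochhammer_eval_mul_inv_Gamma (a + 1) n
  have h2 : (descPochhammer ℤ n).smeval a = (-1) ^ n * (ascPochhammer ℂ n).eval (-a) := by
    rw [ascPochhammer_eval_neg_eq_descPochhammer, ← mul_assoc, ← mul_pow,
      ← descPochhammer_map (Int.castRingHom ℂ), Polynomial.eval_map,
      ← Polynomial.eval₂_smulOneHom_eq_smeval]
    simp
  have h1 : ((-1 : ℂ) ^ n) * (-1) ^ n = 1 := by rw [← mul_pow]; simp
  rw [show (1 : ℂ) - (a + 1) = -a by ring] at h
  rw [Ring.choose_eq_smul, h2, Complex.Gamma_nat_eq_factorial, smul_eq_mul]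
  have h3 : (Complex.Gamma (a + 1 - n))⁻¹
      = (-1) ^ n * ((ascPochhammer ℂ n).eval (-a) * (Complex.Gamma (a + 1))⁻¹) := by
    rw [h, ← mul_assoc, h1, one_mul]
  rw [h3]
  field_simp

/-- The coefficient of `z ^ q` in the binomial series of `(1 + x z) ^ a`, for all integers `q`. -/
noncomputable def binomialTerm (a x : ℂ) (q : ℤ) : ℂ :=
  Complex.Gamma (a + 1) * ((Complex.Gamma (q + 1))⁻¹ * (Complex.Gamma (a + 1 - q))⁻¹) * x ^ q

theorem binomialTerm_of_neg (a x : ℂ) {q : ℤ} (hq : q < 0) : binomialTerm a x q = 0 := by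
  simp [binomialTerm, Gamma_intCast_add_one_of_neg hq]

theorem hasSum_int_iff_nat {f : ℤ → ℂ} (hf : ∀ q < 0, f q = 0) (s : ℂ) :
    HasSum (fun n : ℕ => f n) s ↔ HasSum f s := by
  refine (Nat.cast_injective (R := ℤ)).hasSum_iff fun q hq => hf q ?_
  by_contra h
  exact hq ⟨q.toNat, Int.toNat_of_nonneg (by omega)⟩

theorem hasSum_of_forall_eq {ι : Type*} {f g : ι → ℂ} {a : ℂ} (hg : HasSum g a)
    (h : ∀ i, f i = g i) : HasSum f a := by
  rwa [funext h]

theorem hasSum_binomialTerm {a x z : ℂ} (ha : Complex.Gamma (a + 1) ≠ 0) (hx : ‖x‖ < 1)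
    (hz : ‖z‖ = 1) : HasSum (fun q : ℤ => binomialTerm a x q * z ^ q) ((1 + x * z) ^ a) := by
  rw [← hasSum_int_iff_nat (fun q hq => by rw [binomialTerm_of_neg a x hq, zero_mul])]
  have hxz : x * z ∈ Metric.eball (0 : ℂ) 1 := by
    rw [← ENNReal.ofReal_one, Metric.eball_ofReal]
    simpa [hz] using hx
  have h := (Complex.one_add_cpow_hasFPowerSeriesOnBall_zero (a := a)).hasSum hxz
  rw [zero_add] at h
  refine hasSum_of_forall_eq h fun n => ?_
  rw [binomialSeries_apply, ring_choose_eq_Gamma ha, List.ofFn_const, List.prod_replicate,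
    smul_eq_mul, mul_pow, binomialTerm, zpow_natCast, zpow_natCast, Int.cast_natCast]
  ring

theorem summable_norm_binomialTerm {a x : ℂ} (ha : Complex.Gamma (a + 1) ≠ 0) (hx : ‖x‖ < 1) :
    Summable fun q : ℤ => ‖binomialTerm a x q‖ := by
  have h := (hasSum_binomialTerm ha hx (z := 1) (by simp)).summable.norm
  simpa using h

/-- A Fourier coefficient of the product of two absolutely convergent Laurent series, in `z` and in
`z⁻¹`, on the unit circle: integration term by term keeps the pairs of exponents `(q + d, q)`. -/
theorem hasSum_fourierCoeff_mul {f g : ℤ → ℂ} (hf : Summable fun q => ‖f q‖)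
    (hg : Summable fun q => ‖g q‖) (d : ℤ) {F : ℂ → ℂ}
    (hF : ∀ z : ℂ, ‖z‖ = 1 → F z = (∑' q, f q * z ^ q) * (∑' q, g q * z⁻¹ ^ q) * z ^ (-d)) :
    HasSum (fun q : ℤ => f (q + d) * g q) ((2 * (Real.pi : ℂ))⁻¹ *
      ∫ x in (0 : ℝ)..(2 * Real.pi), F (Complex.exp (Complex.I * (x : ℂ)))) := by
  have hfg : Summable fun p : ℤ × ℤ => ‖f p.1 * g p.2‖ := hf.mul_norm hg
  have hnorm : ∀ x : ℝ, ‖Complex.exp (Complex.I * (x : ℂ))‖ = 1 := fun x => by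
    rw [mul_comm, Complex.norm_exp_ofReal_mul_I]
  have key : HasSum (fun p : ℤ × ℤ => ∫ x in (0 : ℝ)..(2 * Real.pi),
      f p.1 * g p.2 * Complex.exp (((p.1 - p.2 - d : ℤ) : ℂ) * Complex.I * (x : ℂ)))
      (∫ x in (0 : ℝ)..(2 * Real.pi), F (Complex.exp (Complex.I * (x : ℂ)))) := by
    refine intervalIntegral.hasSum_integral_of_dominated_convergence
      (fun p _ => ‖f p.1 * g p.2‖) (fun p => ?_) (fun p => ?_) ?_ ?_ ?_
    · exact Continuous.aestronglyMeasurable (by fun_prop)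
    · refine Filter.Eventually.of_forall fun x _ => le_of_eq ?_
      rw [norm_mul, show ((p.1 - p.2 - d : ℤ) : ℂ) * Complex.I * (x : ℂ)
        = (((p.1 - p.2 - d : ℤ) * x : ℝ) : ℂ) * Complex.I by push_cast; ring,
        Complex.norm_exp_ofReal_mul_I, mul_one]
    · exact Filter.Eventually.of_forall fun x _ => hfg
    · exact intervalIntegrable_const
    · refine Filter.Eventually.of_forall fun x _ => ?_
      set z := Complex.exp (Complex.I * (x : ℂ)) with hz
      have hz0 : z ≠ 0 := Complex.exp_ne_zero _
      have h1 : Summable fun q : ℤ => ‖f q * z ^ q‖ := by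
        simpa [norm_mul, norm_zpow, hz, hnorm x] using hf
      have h2 : Summable fun q : ℤ => ‖g q * z⁻¹ ^ q‖ := by
        simpa [norm_mul, norm_zpow, hz, hnorm x] using hg
      rw [hF z (hnorm x)]
      have s1 : HasSum (fun q : ℤ => f q * z ^ q) (∑' q : ℤ, f q * z ^ q) := h1.of_norm.hasSum
      have s2 : HasSum (fun q : ℤ => g q * z⁻¹ ^ q) (∑' q : ℤ, g q * z⁻¹ ^ q) :=
        h2.of_norm.hasSum
      have s12 : Summable fun p : ℤ × ℤ => (f p.1 * z ^ p.1) * (g p.2 * z⁻¹ ^ p.2) :=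
        summable_mul_of_summable_norm (R := ℂ) (f := fun q : ℤ => f q * z ^ q)
          (g := fun q : ℤ => g q * z⁻¹ ^ q) h1 h2
      refine hasSum_of_forall_eq ((s1.mul s2 s12).mul_right (z ^ (-d))) fun p => ?_
      have hexp : Complex.exp (((p.1 - p.2 - d : ℤ) : ℂ) * Complex.I * (x : ℂ))
          = z ^ p.1 * z⁻¹ ^ p.2 * z ^ (-d) := by
        rw [inv_zpow', ← zpow_add₀ hz0, ← zpow_add₀ hz0, hz, ← Complex.exp_int_mul]
        congr 1
        push_cast
        ring
      rw [hexp]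
      ring
  have hint : ∀ p : ℤ × ℤ, (∫ x in (0 : ℝ)..(2 * Real.pi),
      f p.1 * g p.2 * Complex.exp (((p.1 - p.2 - d : ℤ) : ℂ) * Complex.I * (x : ℂ)))
      = if p.1 = p.2 + d then f p.1 * g p.2 * (2 * Real.pi) else 0 := by
    intro p
    rw [intervalIntegral.integral_const_mul]
    split_ifs with h
    · simp [h]
    · have hn : p.1 - p.2 - d ≠ 0 := by omega
      rw [integral_exp_mul_complex
        (mul_ne_zero (by exact_mod_cast hn) Complex.I_ne_zero)]
      have : Complex.exp (((p.1 - p.2 - d : ℤ) : ℂ) * Complex.I * ((2 * Real.pi : ℝ) : ℂ)) = 1 := by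
        rw [Complex.exp_eq_one_iff]
        exact ⟨p.1 - p.2 - d, by push_cast; ring⟩
      rw [this]
      simp
  simp only [hint] at key
  -- only the pairs `(q + d, q)` contribute
  have hinj : Function.Injective fun q : ℤ => (q + d, q) := fun a b h => congrArg Prod.snd h
  rw [← hinj.hasSum_iff] at key
  · have h := key.mul_left (2 * (Real.pi : ℂ))⁻¹
    have hpi : (2 * (Real.pi : ℂ)) ≠ 0 := by
      simp [Real.pi_ne_zero]
    refine hasSum_of_forall_eq h fun q => ?_
    simp only [Function.comp_apply, if_true]
    field_simp
  · rintro ⟨a, b⟩ hab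
    rw [if_neg]
    intro h
    exact hab ⟨b, Prod.ext h.symm rfl⟩

/-- `log (conj w) = conj (log w)` off the negative axis, so principal powers multiply here. -/
theorem ofReal_norm_cpow_two_mul {w : ℂ} (hw : 0 < w.re) (c : ℂ) :
    (‖w‖ : ℂ) ^ (2 * c) = w ^ c * (starRingEnd ℂ w) ^ c := by
  have hw0 : w ≠ 0 := by rintro rfl; simp at hw
  have harg : w.arg ≠ Real.pi := by
    rw [Ne, Complex.arg_eq_pi_iff]
    intro h; linarith [h.1]
  have hl : (Complex.log (‖w‖ : ℂ)) * 2 = Complex.log w + Complex.log (starRingEnd ℂ w) := by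
    rw [Complex.log_conj _ harg, Complex.add_conj, Complex.log_re, Complex.ofReal_mul,
      Complex.ofReal_log (norm_nonneg _)]
    push_cast
    ring
  have hn : (‖w‖ : ℂ) ≠ 0 := by simpa using hw0
  rw [Complex.cpow_def_of_ne_zero hn, Complex.cpow_def_of_ne_zero hw0,
    Complex.cpow_def_of_ne_zero (by simpa using hw0), ← Complex.exp_add, ← mul_assoc, hl]
  ring_nf

/-- On the unit circle the transformed basis function is, up to constants, the product of a power of
`1 + x z` and a power of `1 + x z⁻¹`, where `x = tanh (τ / 2)`. -/
theorem su11Op_boost_su11Basis (r : ℂ → ℂ) (l : ℂ) (e k : ℤ) (τ : ℝ) {z : ℂ} (hz : ‖z‖ = 1) :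
    su11Op l e (boost τ) (su11Basis r l e k) z
      = (su11Norm r l (k + e / 2))⁻¹ * (Real.cosh (τ / 2) : ℂ) ^ (2 * l)
        * ((1 + (Real.tanh (τ / 2) : ℂ) * z) ^ (l + k + e / 2)
        * (1 + (Real.tanh (τ / 2) : ℂ) * z⁻¹) ^ (l - k - e / 2)) * z ^ (-k) := by
  have hz0 : z ≠ 0 := by rintro rfl; simp at hz
  have hc : 0 < Real.cosh (τ / 2) := Real.cosh_pos _
  have hc' : (Real.cosh (τ / 2) : ℂ) ≠ 0 := by exact_mod_cast hc.ne'
  have hzc : starRingEnd ℂ z = z⁻¹ := by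
    rw [Complex.inv_def, Complex.normSq_eq_norm_sq, hz]; simp
  have hsinh : (Real.sinh (τ / 2) : ℂ) = Real.cosh (τ / 2) * Real.tanh (τ / 2) := by
    rw [Real.tanh_eq_sinh_div_cosh, Complex.ofReal_div]
    field_simp
  have htan : |Real.tanh (τ / 2)| < 1 := Real.abs_tanh_lt_one _
  set W : ℂ := 1 + (Real.tanh (τ / 2) : ℂ) * z with hW
  have hW' : 1 + (Real.tanh (τ / 2) : ℂ) * z⁻¹ = starRingEnd ℂ W := by
    rw [hW, map_add, map_mul, map_one, Complex.conj_ofReal, hzc]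
  have hre : 0 < W.re := by
    have h1 : ‖(Real.tanh (τ / 2) : ℂ) * z‖ < 1 := by
      rw [norm_mul, hz, mul_one, Complex.norm_real]; exact htan
    have h2 := (abs_le.1 (Complex.abs_re_le_norm ((Real.tanh (τ / 2) : ℂ) * z))).1
    rw [hW, Complex.add_re, Complex.one_re]
    linarith
  have hW0 : W ≠ 0 := by rintro h; simp [h] at hre
  have hWc0 : starRingEnd ℂ W ≠ 0 := by simpa using hW0
  have hD : (Real.sinh (τ / 2) : ℂ) * z + Real.cosh (τ / 2) = Real.cosh (τ / 2) * W := by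
    rw [hsinh, hW]; ring
  have hE : (Real.cosh (τ / 2) : ℂ) * z + Real.sinh (τ / 2)
      = Real.cosh (τ / 2) * (z * starRingEnd ℂ W) := by
    rw [hsinh, ← hW']; field_simp
  have hN : ((‖(Real.cosh (τ / 2) : ℂ) * W‖ : ℝ) : ℂ) = (Real.cosh (τ / 2) : ℂ) * (‖W‖ : ℂ) := by
    rw [norm_mul, Complex.norm_real, Real.norm_of_nonneg hc.le]; push_cast; rfl
  simp only [su11Op, su11Basis, boost, Matrix.of_apply, Matrix.cons_val', Matrix.cons_val_zero,
    Matrix.cons_val_one, Matrix.cons_val_fin_one]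
  rw [hD, hE, hN, hW', mul_div_mul_left _ _ hc',
    Complex.mul_cpow_ofReal_nonneg hc.le (norm_nonneg _),
    show 2 * l - (e : ℂ) = 2 * (l - e / 2) by ring, ofReal_norm_cpow_two_mul hre,
    mul_zpow, div_zpow, mul_zpow]
  have h1 : (Real.cosh (τ / 2) : ℂ) ^ (2 * l)
      = (Real.cosh (τ / 2) : ℂ) ^ (2 * (l - e / 2)) * (Real.cosh (τ / 2) : ℂ) ^ e := by
    rw [← Complex.cpow_intCast, ← Complex.cpow_add _ _ hc']
    ring_nf
  have h2 : W ^ (l + k + e / 2) = W ^ (l - e / 2) * W ^ e * (W ^ (-k))⁻¹ := by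
    rw [zpow_neg, inv_inv, ← Complex.cpow_intCast, ← Complex.cpow_intCast,
      ← Complex.cpow_add _ _ hW0, ← Complex.cpow_add _ _ hW0]
    ring_nf
  have h3 : (starRingEnd ℂ W) ^ (l - k - e / 2)
      = (starRingEnd ℂ W) ^ (l - e / 2) * (starRingEnd ℂ W) ^ (-k) := by
    rw [← Complex.cpow_intCast, ← Complex.cpow_add _ _ hWc0]
    push_cast
    ring_nf
  rw [h1, h2, h3]
  ring

theorem IsSqrtGamma.ne_zero {r : ℂ → ℂ} (hr : IsSqrtGamma r) {z : ℂ}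
    (hz : Complex.Gamma z ≠ 0) : r z ≠ 0 := by
  intro h
  apply hz
  rw [← hr, h]
  simp

theorem Gamma_ne_zero_of_add_ne_intCast {l c : ℂ} (h : ∀ j : ℤ, l + c ≠ j) (j : ℤ) :
    Complex.Gamma (l + 1 + (j + c)) ≠ 0 := by
  rw [Ne, Complex.Gamma_eq_zero_iff]
  rintro ⟨n, hn⟩
  refine h (-n - 1 - j) ?_
  push_cast
  linear_combination hn

theorem Gamma_ne_zero_of_sub_ne_intCast {l c : ℂ} (h : ∀ j : ℤ, l - c ≠ j) (j : ℤ) :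
    Complex.Gamma (l + 1 - (j + c)) ≠ 0 := by
  rw [Ne, Complex.Gamma_eq_zero_iff]
  rintro ⟨n, hn⟩
  refine h (-n - 1 + j) ?_
  push_cast
  linear_combination hn

/-- The integral defining a matrix element of a boost is a Fourier coefficient of the product of two
binomial series. The hypotheses on `l` keep the Gamma factors away from their poles. -/
theorem hasSum_jacobiP {r : ℂ → ℂ} (hr : IsSqrtGamma r) {l : ℂ} {e : ℤ}
    (hp : ∀ j : ℤ, l + e / 2 ≠ j) (hm : ∀ j : ℤ, l - e / 2 ≠ j) (i k : ℤ) (τ : ℝ) :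
    HasSum (fun q : ℤ => r (l + 1 - (k + e / 2)) * r (l + 1 + (k + e / 2))
        * r (l + 1 - (i + e / 2)) * r (l + 1 + (i + e / 2))
        * (Real.cosh (τ / 2) : ℂ) ^ (2 * l)
        * matrixTerm (k - i) (l + 1 - (k + e / 2)) (l + 1 + (i + e / 2))
          (Real.tanh (τ / 2) : ℂ) q)
      (jacobiP r l e i k τ) := by
  set x : ℂ := (Real.tanh (τ / 2) : ℂ) with hx
  have hx1 : ‖x‖ < 1 := by
    rw [hx, Complex.norm_real]; exact Real.abs_tanh_lt_one _
  have hΓp := Gamma_ne_zero_of_add_ne_intCast hp k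
  have hΓm := Gamma_ne_zero_of_sub_ne_intCast hm k
  have ep : l + k + e / 2 + 1 = l + 1 + (k + e / 2 : ℂ) := by ring
  have em : l - k - e / 2 + 1 = l + 1 - (k + e / 2 : ℂ) := by ring
  have hf := summable_norm_binomialTerm (ep ▸ hΓp) hx1
  have hg := summable_norm_binomialTerm (em ▸ hΓm) hx1
  have key := hasSum_fourierCoeff_mul hf hg (k - i)
    (F := fun z => (1 + x * z) ^ (l + k + e / 2) * (1 + x * z⁻¹) ^ (l - k - e / 2)
      * z ^ (-(k - i))) fun z hz => by
        rw [(hasSum_binomialTerm (ep ▸ hΓp) hx1 hz).tsum_eq,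
          (hasSum_binomialTerm (em ▸ hΓm) hx1 (z := z⁻¹) (by simp [hz])).tsum_eq]
  have hJ : jacobiP r l e i k τ = su11Norm r l (i + e / 2) * ((su11Norm r l (k + e / 2))⁻¹
      * (Real.cosh (τ / 2) : ℂ) ^ (2 * l)) * ((2 * (Real.pi : ℂ))⁻¹ *
      ∫ y in (0 : ℝ)..(2 * Real.pi), (fun z : ℂ => (1 + x * z) ^ (l + k + e / 2)
        * (1 + x * z⁻¹) ^ (l - k - e / 2) * z ^ (-(k - i)))
          (Complex.exp (Complex.I * (y : ℂ)))) := by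
    rw [jacobiP, su11MatrixElement, mul_assoc (su11Norm r l (i + e / 2)),
      mul_left_comm ((su11Norm r l (k + e / 2))⁻¹ * _),
      ← intervalIntegral.integral_const_mul ((su11Norm r l (k + e / 2))⁻¹ * _)]
    congr 2
    refine intervalIntegral.integral_congr (E := ℂ) fun y _ => ?_
    beta_reduce
    have hz : ‖Complex.exp (Complex.I * (y : ℂ))‖ = 1 := by
      rw [mul_comm, Complex.norm_exp_ofReal_mul_I]
    rw [su11Op_boost_su11Basis r l e k τ hz, ← hx,
      show -(k - i) = -k + i by ring, zpow_add₀ (Complex.exp_ne_zero _)]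
    ring
  rw [hJ]
  refine hasSum_of_forall_eq (key.mul_left _) fun q => ?_
  have hN : (su11Norm r l (k + e / 2))⁻¹ * (Complex.Gamma (l + 1 + (k + e / 2))
      * Complex.Gamma (l + 1 - (k + e / 2)))
      = r (l + 1 + (k + e / 2)) * r (l + 1 - (k + e / 2)) := by
    have h1 := hr.ne_zero hΓp
    have h2 := hr.ne_zero hΓm
    rw [su11Norm, ← hr, ← hr, show l + (k + e / 2 : ℂ) + 1 = l + 1 + (k + e / 2) by ring,
      show l - (k + e / 2 : ℂ) + 1 = l + 1 - (k + e / 2) by ring]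
    field_simp
  have hT : binomialTerm (l + k + e / 2) x (q + (k - i)) * binomialTerm (l - k - e / 2) x q
      = Complex.Gamma (l + 1 + (k + e / 2)) * Complex.Gamma (l + 1 - (k + e / 2))
        * matrixTerm (k - i) (l + 1 - (k + e / 2)) (l + 1 + (i + e / 2)) x q := by
    -- the powers of `x = 0` combine only once the exponents are known to be natural
    by_cases h0 : q < 0
    · rw [binomialTerm_of_neg _ _ h0, matrixTerm_of_neg _ _ _ h0]; simp
    by_cases h1 : k - i + q < 0
    · rw [binomialTerm_of_neg _ _ (q := q + (k - i)) (by omega),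
        matrixTerm_of_add_neg _ _ _ h1]
      simp
    have hpow : x ^ (k - i + 2 * q) = x ^ (q + (k - i)) * x ^ q := by
      obtain ⟨a, ha⟩ : ∃ a : ℕ, q + (k - i) = a := ⟨_, (Int.toNat_of_nonneg (by omega)).symm⟩
      obtain ⟨b, rfl⟩ : ∃ b : ℕ, q = b := ⟨_, (Int.toNat_of_nonneg (by omega)).symm⟩
      rw [ha, show k - i + 2 * (b : ℤ) = ((a + b : ℕ) : ℤ) by push_cast; omega,
        zpow_natCast, zpow_natCast, zpow_natCast, pow_add]
    rw [binomialTerm, binomialTerm, matrixTerm, hpow, ep, em]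
    push_cast
    rw [show l + 1 + (k + e / 2 : ℂ) - (q + (k - i)) = l + 1 + (i + e / 2) - q by ring,
      show (q : ℂ) + (k - i) + 1 = k - i + q + 1 by ring]
    ring
  rw [hT, su11Norm, show l + (i + e / 2 : ℂ) + 1 = l + 1 + (i + e / 2) by ring,
      show l - (i + e / 2 : ℂ) + 1 = l + 1 - (i + e / 2) by ring]
  linear_combination (-(r (l + 1 + (i + e / 2)) * r (l + 1 - (i + e / 2))
    * (Real.cosh (τ / 2) : ℂ) ^ (2 * l)
    * matrixTerm (k - i) (l + 1 - (k + e / 2)) (l + 1 + (i + e / 2)) x q)) * hN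

/-! ### Closed forms of the two factors -/

theorem sphericalP_comm (L i p : ℕ) (hi : i ≤ L) (hp : p ≤ L) (θ : ℝ)
    (hc : Real.cos (θ / 2) ≠ 0) : sphericalP L i p θ = sphericalP L p i θ := by
  rw [sphericalP_eq_matrixSeries L i p hi hp θ hc, sphericalP_eq_matrixSeries L p i hp hi θ hc,
    matrixSeries_swap, Nat.cast_sub hi, Nat.cast_sub hp]
  push_cast
  rw [show -((i : ℤ) - p) = p - i by ring, show (L : ℂ) - i + 1 + (i - p) = L - p + 1 by ring,
    show (p : ℂ) + 1 + (i - p) = i + 1 by ring]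
  ring

theorem sphericalP_eq_sum_Icc (L i p : ℕ) (hi : i ≤ L) (hp : p ≤ L) (θ : ℝ)
    (hc : Real.cos (θ / 2) ≠ 0) :
    sphericalP L i p θ = Complex.I ^ ((i : ℤ) - p)
      * (Real.sqrt ((L - i).factorial * i.factorial * (L - p).factorial * p.factorial) : ℂ)
      * (Real.cos (θ / 2) : ℂ) ^ L * (Real.tan (θ / 2) : ℂ) ^ ((i : ℤ) - p)
      * ∑ j ∈ Finset.Icc (max 0 ((p : ℤ) - i)) (min ((L : ℤ) - i) p),
        Complex.I ^ (2 * j) * (Real.tan (θ / 2) : ℂ) ^ (2 * j)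
          / (Complex.Gamma (j + 1) * Complex.Gamma (L - i - j + 1)
            * Complex.Gamma (p - j + 1) * Complex.Gamma (i - p + j + 1)) := by
  have hN : (su2Norm L i : ℂ) * su2Norm L p
      = (Real.sqrt ((L - i).factorial * i.factorial * (L - p).factorial * p.factorial) : ℂ) := by
    rw [← Complex.ofReal_mul, su2Norm, su2Norm, ← Real.sqrt_mul (by positivity)]
    congr 2
    ring
  rw [sphericalP_eq_matrixSeries L i p hi hp θ hc, hN, matrixSeries_natCast_eq_sum_Icc, mul_zpow,
    Nat.cast_sub hi, show -((i : ℤ) - p) = p - i by ring]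
  have hs : ∀ j : ℤ, (Complex.I * (Real.tan (θ / 2) : ℂ)) ^ (2 * j)
      / (Complex.Gamma (j + 1) * Complex.Gamma ((L - i : ℕ) + 1 - j)
        * Complex.Gamma (p + 1 - j) * Complex.Gamma (((i : ℤ) - p : ℤ) + j + 1))
      = Complex.I ^ (2 * j) * (Real.tan (θ / 2) : ℂ) ^ (2 * j)
          / (Complex.Gamma (j + 1) * Complex.Gamma (L - i - j + 1)
            * Complex.Gamma (p - j + 1) * Complex.Gamma (i - p + j + 1)) := by
    intro j
    rw [mul_zpow, Nat.cast_sub hi]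
    push_cast
    rw [show (L : ℂ) - i + 1 - j = L - i - j + 1 by ring,
      show (p : ℂ) + 1 - j = p - j + 1 by ring]
  simp only [hs]
  ring

theorem sqrt_mul_div_self (a b : ℕ) :
    Real.sqrt (a.factorial * b.factorial) / b.factorial
      = Real.sqrt (a.factorial / b.factorial) := by
  have hb : (0 : ℝ) < b.factorial := by positivity
  rw [Real.sqrt_mul (by positivity), Real.sqrt_div (by positivity), mul_div_assoc,
    Real.sqrt_div_self, div_eq_mul_inv]

theorem sphericalP_eq_regularized2F1 (L i p : ℕ) (hi : i ≤ L) (hp : p ≤ L) (θ : ℝ)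
    (hc : Real.cos (θ / 2) ≠ 0) :
    sphericalP L i p θ = (Real.sqrt (i.factorial / (L - i).factorial) : ℂ)
      * (Real.sqrt ((L - p).factorial / p.factorial) : ℂ)
      * (Real.cos (θ / 2) : ℂ) ^ L
      * Complex.I ^ ((i : ℤ) - p) * (Real.tan (θ / 2) : ℂ) ^ ((i : ℤ) - p)
      * regularized2F1 (i - L) (-p) (i - p + 1) (-(Real.tan (θ / 2) : ℂ) ^ 2) := by
  have h1 : (Real.sqrt (i.factorial / (L - i).factorial) : ℂ)
      = su2Norm L i / (L - i).factorial := by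
    rw [← sqrt_mul_div_self, su2Norm]; push_cast; rfl
  have h2 : (Real.sqrt ((L - p).factorial / p.factorial) : ℂ) = su2Norm L p / p.factorial := by
    rw [← sqrt_mul_div_self, su2Norm, mul_comm]; push_cast; rfl
  rw [sphericalP_eq_matrixSeries L i p hi hp θ hc, matrixSeries_eq_regularized2F1, h1, h2,
    Complex.Gamma_nat_eq_factorial, Complex.Gamma_nat_eq_factorial, mul_zpow, mul_pow,
    Complex.I_sq, Nat.cast_sub hi]
  push_cast
  rw [show (1 : ℂ) - (L - i + 1) = i - L by ring, show (1 : ℂ) - (p + 1) = -p by ring,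
    neg_one_mul]
  ring

theorem sphericalP_eq_ordinaryHypergeometric (L i p : ℕ) (hi : i ≤ L) (hpi : p ≤ i) (θ : ℝ)
    (hc : Real.cos (θ / 2) ≠ 0) :
    sphericalP L i p θ = (Real.cos (θ / 2) : ℂ) ^ L
      * (Complex.I ^ (i - p) / (Complex.Gamma ((i - p : ℕ) + 1))
      * (Real.sqrt (i.factorial * (L - p).factorial / ((L - i).factorial * p.factorial)) : ℂ)
      * (Real.tan (θ / 2) : ℂ) ^ (i - p)
      * ordinaryHypergeometric (i - L : ℂ) (-p : ℂ) (i - p + 1 : ℂ)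
          (-(Real.tan (θ / 2) : ℂ) ^ 2)) := by
  have h1 : (Real.sqrt (i.factorial * (L - p).factorial / ((L - i).factorial * p.factorial)) : ℂ)
      = (Real.sqrt (i.factorial / (L - i).factorial) : ℂ)
      * (Real.sqrt ((L - p).factorial / p.factorial) : ℂ) := by
    rw [← Complex.ofReal_mul, ← Real.sqrt_mul (by positivity), div_mul_div_comm]
  have h2 : (i : ℂ) - p = (i - p : ℕ) := by rw [Nat.cast_sub hpi]
  rw [sphericalP_eq_regularized2F1 L i p hi (hpi.trans hi) θ hc, h1, h2,
    regularized2F1_natCast_add_one, ← Int.ofNat_sub hpi, zpow_natCast, zpow_natCast]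
  ring

section Boost

variable {r : ℂ → ℂ} {l : ℂ} {e : ℤ}

theorem jacobiP_eq_matrixSeries (hr : IsSqrtGamma r)
    (hp : ∀ j : ℤ, l + e / 2 ≠ j) (hm : ∀ j : ℤ, l - e / 2 ≠ j) (i k : ℤ) (τ : ℝ) :
    jacobiP r l e i k τ = r (l + 1 - (k + e / 2)) * r (l + 1 + (k + e / 2))
        * r (l + 1 - (i + e / 2)) * r (l + 1 + (i + e / 2))
        * (Real.cosh (τ / 2) : ℂ) ^ (2 * l)
        * matrixSeries (k - i) (l + 1 - (k + e / 2)) (l + 1 + (i + e / 2))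
          (Real.tanh (τ / 2) : ℂ) := by
  rw [← (hasSum_jacobiP hr hp hm i k τ).tsum_eq, tsum_mul_left, matrixSeries]

theorem jacobiP_comm (hr : IsSqrtGamma r)
    (hp : ∀ j : ℤ, l + e / 2 ≠ j) (hm : ∀ j : ℤ, l - e / 2 ≠ j) (i k : ℤ) (τ : ℝ) :
    jacobiP r l e i k τ = jacobiP r l e k i τ := by
  rw [jacobiP_eq_matrixSeries hr hp hm, jacobiP_eq_matrixSeries hr hp hm, matrixSeries_swap]
  push_cast
  rw [neg_sub, show l + 1 - (k + e / 2 : ℂ) + (k - i) = l + 1 - (i + e / 2) by ring,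
    show l + 1 + (i + e / 2 : ℂ) + (k - i) = l + 1 + (k + e / 2) by ring]
  ring

theorem summable_jacobiP_series (hr : IsSqrtGamma r)
    (hp : ∀ j : ℤ, l + e / 2 ≠ j) (hm : ∀ j : ℤ, l - e / 2 ≠ j) (i k : ℤ) (τ : ℝ) {h n t : ℂ}
    (hh : h = l + 1) (hn : n = k + e / 2) (ht : t = i + e / 2) :
    Summable fun s : Set.Ici (i - k).toNat => (Real.tanh (τ / 2) : ℂ) ^ (2 * (s : ℕ))
      / (Complex.Gamma ((s : ℕ) + 1) * Complex.Gamma (h - n - (s : ℕ))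
        * Complex.Gamma (h + t - (s : ℕ)) * Complex.Gamma (n - t + (s : ℕ) + 1)) := by
  have hK : (Real.cosh (τ / 2) : ℂ) ^ (2 * l) ≠ 0 := by
    rw [Complex.cpow_def_of_ne_zero (by exact_mod_cast (Real.cosh_pos _).ne')]
    exact Complex.exp_ne_zero _
  have hc : r (l + 1 - (k + e / 2)) * r (l + 1 + (k + e / 2)) * r (l + 1 - (i + e / 2))
      * r (l + 1 + (i + e / 2)) * (Real.cosh (τ / 2) : ℂ) ^ (2 * l) ≠ 0 := by
    refine mul_ne_zero (mul_ne_zero (mul_ne_zero (mul_ne_zero ?_ ?_) ?_) ?_) hK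
    · exact hr.ne_zero (Gamma_ne_zero_of_sub_ne_intCast hm k)
    · exact hr.ne_zero (Gamma_ne_zero_of_add_ne_intCast hp k)
    · exact hr.ne_zero (Gamma_ne_zero_of_sub_ne_intCast hm i)
    · exact hr.ne_zero (Gamma_ne_zero_of_add_ne_intCast hp i)
  have hs := summable_Ici_of_summable_matrixTerm
    ((summable_mul_left_iff hc).1 (hasSum_jacobiP hr hp hm i k τ).summable)
  have hnt : n - t = ((k - i : ℤ) : ℂ) := by rw [hn, ht]; push_cast; ring
  rw [neg_sub] at hs
  rw [hnt, hh, hn, ht]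
  exact hs

theorem jacobiP_eq_tsum (hr : IsSqrtGamma r)
    (hp : ∀ j : ℤ, l + e / 2 ≠ j) (hm : ∀ j : ℤ, l - e / 2 ≠ j) (i k : ℤ) (τ : ℝ) {h n t : ℂ}
    (hh : h = l + 1) (hn : n = k + e / 2) (ht : t = i + e / 2) :
    jacobiP r l e i k τ = (r (h - n) * r (h + n) * r (h - t) * r (h + t))
      * (Real.cosh (τ / 2) : ℂ) ^ (2 * l) * (Real.tanh (τ / 2) : ℂ) ^ (k - i)
      * ∑' s : Set.Ici (i - k).toNat, (Real.tanh (τ / 2) : ℂ) ^ (2 * (s : ℕ))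
        / (Complex.Gamma ((s : ℕ) + 1) * Complex.Gamma (h - n - (s : ℕ))
          * Complex.Gamma (h + t - (s : ℕ)) * Complex.Gamma (n - t + (s : ℕ) + 1)) := by
  have hnt : n - t = ((k - i : ℤ) : ℂ) := by rw [hn, ht]; push_cast; ring
  rw [jacobiP_eq_matrixSeries hr hp hm, matrixSeries_eq_tsum_Ici, neg_sub, hnt, hh, hn, ht]
  ring

theorem jacobiP_eq_regularized2F1 (hr : IsSqrtGamma r)
    (hp : ∀ j : ℤ, l + e / 2 ≠ j) (hm : ∀ j : ℤ, l - e / 2 ≠ j) (i k : ℤ) (τ : ℝ) {h n t : ℂ}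
    (hh : h = l + 1) (hn : n = k + e / 2) (ht : t = i + e / 2) :
    jacobiP r l e i k τ = (r (h + n) / r (h - n)) * (r (h - t) / r (h + t))
      * (Real.cosh (τ / 2) : ℂ) ^ (2 * l) * (Real.tanh (τ / 2) : ℂ) ^ (k - i)
      * regularized2F1 (n - l) (-t - l) (n - t + 1) ((Real.tanh (τ / 2) : ℂ) ^ 2) := by
  have hnt : n - t = ((k - i : ℤ) : ℂ) := by rw [hn, ht]; push_cast; ring
  have h1 := hr.ne_zero (Gamma_ne_zero_of_sub_ne_intCast hm k)
  have h2 := hr.ne_zero (Gamma_ne_zero_of_add_ne_intCast hp i)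
  rw [← hn, ← hh] at h1
  rw [← ht, ← hh] at h2
  rw [jacobiP_eq_matrixSeries hr hp hm, matrixSeries_eq_regularized2F1, hnt, ← hn, ← ht, ← hh,
    show 1 - (h - n) = n - l by rw [hh]; ring, show 1 - (h + t) = -t - l by rw [hh]; ring,
    ← hr, ← hr]
  field_simp

theorem jacobiP_eq_ordinaryHypergeometric (hr : IsSqrtGamma r)
    (hp : ∀ j : ℤ, l + e / 2 ≠ j) (hm : ∀ j : ℤ, l - e / 2 ≠ j) (i k : ℤ) (τ : ℝ) {h n t : ℂ}
    (hh : h = l + 1) (hn : n = k + e / 2) (ht : t = i + e / 2) {a : ℕ} (ha : k = i + a) :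
    jacobiP r l e i k τ = (Real.cosh (τ / 2) : ℂ) ^ (2 * l)
      * ((r (h + n) * r (h - t) / (r (h - n) * r (h + t))) / Complex.Gamma (a + 1)
      * (Real.tanh (τ / 2) : ℂ) ^ a
      * ordinaryHypergeometric (n - l) (-t - l) (n - t + 1) ((Real.tanh (τ / 2) : ℂ) ^ 2)) := by
  have hnt : n - t = (a : ℂ) := by rw [hn, ht, ha]; push_cast; ring
  rw [jacobiP_eq_regularized2F1 hr hp hm i k τ hh hn ht, hnt, regularized2F1_natCast_add_one,
    show k - i = (a : ℤ) by omega, zpow_natCast]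
  ring

end Boost

/-! ### The relativistic spherical functions -/

theorem principalSpherical_eq (r : ℂ → ℂ) (L i : ℕ) (ρ : ℂ) (k : ℤ) (φ ε θ τ ψ ε' : ℝ) :
    principalSpherical r ρ L i k (φ - Complex.I * ε) (θ - Complex.I * τ) (ψ - Complex.I * ε')
      = Complex.exp (-((i : ℂ) - L / 2) * (ε + Complex.I * φ))
        * (∑ p ∈ Finset.range (L + 1), sphericalP L i p θ
          * jacobiP r (-1 / 2 + Complex.I * ρ) (-(L : ℤ)) p k τ)
        * Complex.exp (-((k : ℂ) - L / 2) * (ε' + Complex.I * ψ)) := by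
  have hre : ((θ : ℂ) - Complex.I * τ).re = θ := by simp
  have him : -((θ : ℂ) - Complex.I * τ).im = τ := by simp
  rw [principalSpherical, principalZ, hre, him]
  congr 2
  · congr 1
    linear_combination ((i : ℂ) - L / 2) * ε * Complex.I_sq
  · linear_combination ((k : ℂ) - L / 2) * ε' * Complex.I_sq

theorem supplementarySpherical_eq (r : ℂ → ℂ) (σ : ℝ) (m n : ℤ) (φ ε θ τ ψ ε' : ℝ) :
    supplementarySpherical r σ m n (φ - Complex.I * ε) (θ - Complex.I * τ) (ψ - Complex.I * ε')
      = Complex.exp (-(m : ℂ) * (ε + Complex.I * φ))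
        * jacobiP r (-1 / 2 - σ) 0 m n τ
        * Complex.exp (-(n : ℂ) * (ε' + Complex.I * ψ)) := by
  have him : -((θ : ℂ) - Complex.I * τ).im = τ := by simp
  rw [supplementarySpherical, him]
  congr 2
  · congr 1
    linear_combination (m : ℂ) * ε * Complex.I_sq
  · linear_combination (n : ℂ) * ε' * Complex.I_sq

theorem sphericalP_zero (θ : ℝ) : sphericalP 0 0 0 θ = 1 := by
  simp [sphericalP, su2MatrixElement_eq_sum 0 0 0 le_rfl, su2Norm]

end LorentzSpherical

theorem mainTheorem5 (r : ℂ → ℂ) (hr : LorentzSpherical.IsSqrtGamma r)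
    (φ ε θ τ ψ ε' : ℝ) (hθ₀ : 0 ≤ θ) (hθπ : θ ≤ Real.pi)
    (φc θc ψc : ℂ) (hφc : φc = φ - Complex.I * ε) (hθc : θc = θ - Complex.I * τ)
    (hψc : ψc = ψ - Complex.I * ε') :
    -- principal series
    (∀ (L : ℕ) (ρ : ℝ), (ρ ≠ 0 ∨ Even L) → ∀ i : ℕ, i ≤ L → ∀ k : ℤ,
      let l₀ : ℝ := (L : ℝ) / 2
      let m : ℝ := (i : ℝ) - l₀
      let n : ℝ := (k : ℝ) - l₀
      let t : ℕ → ℝ := fun p => (p : ℝ) - l₀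
      let h : ℂ := 1 / 2 + Complex.I * ρ
      let T : ℂ := (Real.tan (θ / 2) : ℂ)
      let H : ℂ := (Real.tanh (τ / 2) : ℂ)
      let C : ℂ := (Real.cos (θ / 2) : ℂ) ^ L
      let K : ℂ := (Real.cosh (τ / 2) : ℂ) ^ (-1 + 2 * Complex.I * (ρ : ℂ))
      let E : ℂ := Complex.exp (-(m : ℂ) * (ε + Complex.I * φ) - n * (ε' + Complex.I * ψ))
      let M : ℂ := LorentzSpherical.principalSpherical r ρ L i k φc θc ψc
      -- factorization through the generalized spherical and the Jacobi functions
      (M = Complex.exp (-(m : ℂ) * (ε + Complex.I * φ))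
          * (∑ p ∈ Finset.range (L + 1), LorentzSpherical.sphericalP L i p θ
              * LorentzSpherical.jacobiP r (-1 / 2 + Complex.I * ρ) (-(L : ℤ)) p k τ)
          * Complex.exp (-(n : ℂ) * (ε' + Complex.I * ψ))) ∧
      (θ < Real.pi →
        -- explicit series
        ((∀ p ∈ Finset.range (L + 1), Summable fun s : Set.Ici ((p : ℤ) - k).toNat =>
            H ^ (2 * (s : ℕ)) / (Complex.Gamma ((s : ℕ) + 1) * Complex.Gamma (h - n - (s : ℕ))
              * Complex.Gamma (h + t p - (s : ℕ)) * Complex.Gamma (n - t p + (s : ℕ) + 1))) ∧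
          M = E * ∑ p ∈ Finset.range (L + 1),
            Complex.I ^ ((i : ℤ) - p)
            * (Real.sqrt (Real.Gamma (l₀ - m + 1) * Real.Gamma (l₀ + m + 1)
                * Real.Gamma (l₀ - t p + 1) * Real.Gamma (l₀ + t p + 1)) : ℂ)
            * C * T ^ ((i : ℤ) - p)
            * (∑ j ∈ Finset.Icc (max 0 ((p : ℤ) - i)) (min ((L : ℤ) - i) p),
                Complex.I ^ (2 * j) * T ^ (2 * j)
                / ((Real.Gamma (j + 1) * Real.Gamma (l₀ - m - j + 1)
                  * Real.Gamma (l₀ + t p - j + 1) * Real.Gamma (m - t p + j + 1) : ℝ) : ℂ))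
            * (r (h - n) * r (h + n) * r (h - t p) * r (h + t p))
            * K * H ^ (k - p)
            * ∑' s : Set.Ici ((p : ℤ) - k).toNat,
                H ^ (2 * (s : ℕ)) / (Complex.Gamma ((s : ℕ) + 1) * Complex.Gamma (h - n - (s : ℕ))
                  * Complex.Gamma (h + t p - (s : ℕ))
                  * Complex.Gamma (n - t p + (s : ℕ) + 1))) ∧
        -- products of two hypergeometric functions, first form
        (M = E * ((Real.sqrt (Real.Gamma (l₀ + m + 1) / Real.Gamma (l₀ - m + 1)) : ℂ)
            * (r (h - n) / r (h + n)) * C * K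
            * ∑ p ∈ Finset.range (L + 1),
              (Real.sqrt (Real.Gamma (l₀ - t p + 1) / Real.Gamma (l₀ + t p + 1)) : ℂ)
              * (r (h + t p) / r (h - t p))
              * Complex.I ^ ((i : ℤ) - p) * T ^ ((i : ℤ) - p) * H ^ ((p : ℤ) - k)
              * LorentzSpherical.regularized2F1 (m - l₀) (-t p - l₀) (m - t p + 1) (-T ^ 2)
              * LorentzSpherical.regularized2F1 (t p - Complex.I * ρ + 1 / 2)
                  (-n - Complex.I * ρ + 1 / 2) (t p - n + 1) (H ^ 2))) ∧
        -- products of two hypergeometric functions, second form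
        (M = E * ((Real.sqrt (Real.Gamma (l₀ - m + 1) / Real.Gamma (l₀ + m + 1)) : ℂ)
            * (r (h + n) / r (h - n)) * C * K
            * ∑ p ∈ Finset.range (L + 1),
              (Real.sqrt (Real.Gamma (l₀ + t p + 1) / Real.Gamma (l₀ - t p + 1)) : ℂ)
              * (r (h - t p) / r (h + t p))
              * Complex.I ^ ((p : ℤ) - i) * T ^ ((p : ℤ) - i) * H ^ (k - p)
              * LorentzSpherical.regularized2F1 (t p - l₀) (-m - l₀) (t p - m + 1) (-T ^ 2)
              * LorentzSpherical.regularized2F1 (n - Complex.I * ρ + 1 / 2)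
                  (-t p - Complex.I * ρ + 1 / 2) (n - t p + 1) (H ^ 2))) ∧
        -- products of two ordinary hypergeometric functions, each taken in the order of its
        -- two indices for which the third parameter is a positive integer
        (M = E * (C * K * ∑ p ∈ Finset.range (L + 1),
            (let A : ℝ := max m (t p)
             let B : ℝ := min m (t p)
             let a : ℕ := ((i : ℤ) - p).natAbs
             Complex.I ^ a / (Real.Gamma (a + 1) : ℂ)
              * (Real.sqrt (Real.Gamma (l₀ + A + 1) * Real.Gamma (l₀ - B + 1)
                  / (Real.Gamma (l₀ - A + 1) * Real.Gamma (l₀ + B + 1))) : ℂ)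
              * T ^ a
              * ordinaryHypergeometric ((A - l₀ : ℝ) : ℂ) ((-B - l₀ : ℝ) : ℂ)
                  ((A - B + 1 : ℝ) : ℂ) (-T ^ 2))
            * (let A : ℝ := max (t p) n
               let B : ℝ := min (t p) n
               let a : ℕ := ((p : ℤ) - k).natAbs
               (r (h + A) * r (h - B) / (r (h - A) * r (h + B))) / (Real.Gamma (a + 1) : ℂ)
                * H ^ a
                * ordinaryHypergeometric (A - Complex.I * ρ + 1 / 2)
                    (-B - Complex.I * ρ + 1 / 2) ((A - B + 1 : ℝ) : ℂ) (H ^ 2)))))) ∧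
    -- supplementary series
    (∀ σ : ℝ, (∀ z : ℤ, σ ≠ z + 1 / 2) →
      -- the case `l₀ = 0`, `ρ = i σ` of the principal series
      (∀ n : ℤ,
        LorentzSpherical.principalZ r (Complex.I * σ) 0 0 n θc
          = LorentzSpherical.jacobiP r (-1 / 2 - σ) 0 0 n τ ∧
        LorentzSpherical.principalSpherical r (Complex.I * σ) 0 0 n φc θc ψc
          = LorentzSpherical.supplementarySpherical r σ 0 n φc θc ψc) ∧
      ∀ m n : ℤ,
        let h : ℂ := 1 / 2 - σ
        let H : ℂ := (Real.tanh (τ / 2) : ℂ)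
        let K : ℂ := (Real.cosh (τ / 2) : ℂ) ^ (-1 - 2 * (σ : ℂ))
        let E : ℂ := Complex.exp (-(m : ℂ) * (ε + Complex.I * φ) - n * (ε' + Complex.I * ψ))
        let M : ℂ := LorentzSpherical.supplementarySpherical r σ m n φc θc ψc
        (M = Complex.exp (-(m : ℂ) * (ε + Complex.I * φ))
            * LorentzSpherical.jacobiP r (-1 / 2 - σ) 0 m n τ
            * Complex.exp (-(n : ℂ) * (ε' + Complex.I * ψ))) ∧
        (Summable fun s : Set.Ici (m - n).toNat =>
            H ^ (2 * (s : ℕ)) / (Complex.Gamma ((s : ℕ) + 1) * Complex.Gamma (h - n - (s : ℕ))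
              * Complex.Gamma (h + m - (s : ℕ)) * Complex.Gamma (n - m + (s : ℕ) + 1))) ∧
        (M = E * ((r (h - n) * r (h + n) * r (h - m) * r (h + m)) * K * H ^ (n - m)
            * ∑' s : Set.Ici (m - n).toNat,
                H ^ (2 * (s : ℕ)) / (Complex.Gamma ((s : ℕ) + 1) * Complex.Gamma (h - n - (s : ℕ))
                  * Complex.Gamma (h + m - (s : ℕ)) * Complex.Gamma (n - m + (s : ℕ) + 1)))) ∧
        (n ≤ m → M = E * ((r (h + m) * r (h - n) / (r (h - m) * r (h + n)))
            / Complex.Gamma (m - n + 1) * K * H ^ (m - n)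
            * ordinaryHypergeometric ((m : ℂ) + σ + 1 / 2) (-(n : ℂ) + σ + 1 / 2)
                ((m : ℂ) - n + 1) (H ^ 2))) ∧
        (m ≤ n → M = E * ((r (h + n) * r (h - m) / (r (h - n) * r (h + m)))
            / Complex.Gamma (n - m + 1) * K * H ^ (n - m)
            * ordinaryHypergeometric ((n : ℂ) + σ + 1 / 2) (-(m : ℂ) + σ + 1 / 2)
                ((n : ℂ) - m + 1) (H ^ 2)))) := by
  subst hφc hθc hψc
  refine ⟨?_, ?_⟩
  · intro L ρ hρ i hi k l₀ m n t h T H C K E M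
    -- `-1 / 2 + iρ` is not congruent modulo `1` to a weight or to minus a weight, so that none of
    -- the Gamma factors is at a pole
    have hlab : ∀ a : ℝ, (a = (L : ℝ) / 2 ∨ a = -((L : ℝ) / 2)) → ∀ j : ℤ,
        -1 / 2 + Complex.I * (ρ : ℂ) + a ≠ j := by
      intro a ha j hj
      have him := congrArg Complex.im hj
      simp at him
      rcases hρ with hρ | ⟨b, hb⟩
      · exact hρ him
      · have hb' : (L : ℝ) / 2 = b := by rw [hb]; push_cast; ring
        rw [hb'] at ha
        have h2 : (-1 : ℝ) + 2 * a = 2 * j := by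
          have : (-1 / 2 : ℝ) + a = j := by
            have h3 : (-1 / 2 + Complex.I * (ρ : ℂ) + a) = ((-1 / 2 + a : ℝ) : ℂ) := by
              rw [him]; push_cast; ring
            rw [h3] at hj
            exact_mod_cast hj
          linarith
        rcases ha with rfl | rfl
        · have : (-1 : ℤ) + 2 * b = 2 * j := by exact_mod_cast h2
          omega
        · have : (-1 : ℤ) + 2 * (-(b : ℤ)) = 2 * j := by exact_mod_cast h2
          omega
    have hp : ∀ j : ℤ, -1 / 2 + Complex.I * (ρ : ℂ) + ((-(L : ℤ) : ℤ) : ℂ) / 2 ≠ j := by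
      intro j
      convert hlab _ (Or.inr rfl) j using 2
      push_cast; ring
    have hm : ∀ j : ℤ, -1 / 2 + Complex.I * (ρ : ℂ) - ((-(L : ℤ) : ℤ) : ℂ) / 2 ≠ j := by
      intro j
      have e : -1 / 2 + Complex.I * (ρ : ℂ) - ((-(L : ℤ) : ℤ) : ℂ) / 2
          = -1 / 2 + Complex.I * (ρ : ℂ) + (((L : ℝ) / 2 : ℝ) : ℂ) := by
        push_cast; ring
      rw [e]
      exact hlab _ (Or.inl rfl) j
    have hmC : (m : ℂ) = (i : ℂ) - L / 2 := by simp [m, l₀]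
    have hn : (n : ℂ) = k + ((-(L : ℤ) : ℤ) : ℂ) / 2 := by simp [n, l₀]; ring
    have ht : ∀ p : ℕ, (t p : ℂ) = (p : ℤ) + ((-(L : ℤ) : ℤ) : ℂ) / 2 := by
      intro p; simp [t, l₀]; ring
    have hl₀ : (l₀ : ℂ) = (L : ℂ) / 2 := by simp [l₀]
    have hh : h = -1 / 2 + Complex.I * (ρ : ℂ) + 1 := by simp only [h]; ring
    have hK : (Real.cosh (τ / 2) : ℂ) ^ (2 * (-1 / 2 + Complex.I * (ρ : ℂ))) = K := by
      simp only [K]; congr 1; ring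
    have hfac : M = Complex.exp (-(m : ℂ) * (ε + Complex.I * φ))
          * (∑ p ∈ Finset.range (L + 1), LorentzSpherical.sphericalP L i p θ
              * LorentzSpherical.jacobiP r (-1 / 2 + Complex.I * ρ) (-(L : ℤ)) p k τ)
          * Complex.exp (-(n : ℂ) * (ε' + Complex.I * ψ)) := by
      have hnC : (n : ℂ) = (k : ℂ) - L / 2 := by simp [n, l₀]
      rw [hmC, hnC]
      exact LorentzSpherical.principalSpherical_eq r L i ρ k φ ε θ τ ψ ε'
    have hM : M = E * ∑ p ∈ Finset.range (L + 1), LorentzSpherical.sphericalP L i p θ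
              * LorentzSpherical.jacobiP r (-1 / 2 + Complex.I * ρ) (-(L : ℤ)) p k τ := by
      have hE : E = Complex.exp (-(m : ℂ) * (ε + Complex.I * φ))
          * Complex.exp (-(n : ℂ) * (ε' + Complex.I * ψ)) := by
        simp only [E]
        rw [← Complex.exp_add]
        congr 1
        ring
      rw [hfac, hE]
      ring
    refine ⟨hfac, fun hθ => ?_⟩
    have hc : Real.cos (θ / 2) ≠ 0 :=
      (Real.cos_pos_of_mem_Ioo ⟨by linarith, by linarith⟩).ne'
    -- the real Gamma factors are factorials, since `l₀ ± m` and `l₀ ± t` are natural numbers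
    have hG1 : Real.Gamma (l₀ + m + 1) = i.factorial := by
      rw [← Real.Gamma_nat_eq_factorial]; simp only [m]; congr 1; ring
    have hG2 : Real.Gamma (l₀ - m + 1) = (L - i).factorial := by
      rw [← Real.Gamma_nat_eq_factorial, Nat.cast_sub hi]; simp only [m, l₀]; congr 1; ring
    have hG3 : ∀ p : ℕ, Real.Gamma (l₀ + t p + 1) = p.factorial := fun p => by
      rw [← Real.Gamma_nat_eq_factorial]; simp only [t]; congr 1; ring
    have hG4 : ∀ p : ℕ, p ≤ L → Real.Gamma (l₀ - t p + 1) = (L - p).factorial := fun p hpL => by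
      rw [← Real.Gamma_nat_eq_factorial, Nat.cast_sub hpL]; simp only [t, l₀]; congr 1; ring
    have hle : ∀ p ∈ Finset.range (L + 1), p ≤ L := fun p hpL => by
      rw [Finset.mem_range] at hpL; omega
    have htC : ∀ p : ℕ, (t p : ℂ) = (p : ℂ) - L / 2 := by intro p; simp [t, l₀]
    refine ⟨⟨?_, ?_⟩, ?_, ?_, ?_⟩
    · intro p _
      exact LorentzSpherical.summable_jacobiP_series hr hp hm p k τ hh hn (ht p)
    · rw [hM]
      congr 1
      refine Finset.sum_congr rfl fun p hpL => ?_
      have hpL := hle p hpL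
      have hfin : ∀ j : ℤ, ((Real.Gamma (j + 1) * Real.Gamma (l₀ - m - j + 1)
          * Real.Gamma (l₀ + t p - j + 1) * Real.Gamma (m - t p + j + 1) : ℝ) : ℂ)
          = Complex.Gamma (j + 1) * Complex.Gamma (L - i - j + 1)
            * Complex.Gamma (p - j + 1) * Complex.Gamma (i - p + j + 1) := by
        intro j
        simp only [Complex.ofReal_mul, ← Complex.Gamma_ofReal]
        push_cast
        rw [hl₀, hmC, htC, show (L : ℂ) / 2 - (i - L / 2) - j + 1 = L - i - j + 1 by ring,
          show (L : ℂ) / 2 + (p - L / 2) - j + 1 = p - j + 1 by ring,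
          show (i : ℂ) - L / 2 - (p - L / 2) + j + 1 = i - p + j + 1 by ring]
      simp only [hfin]
      rw [LorentzSpherical.sphericalP_eq_sum_Icc L i p hi hpL θ hc,
        LorentzSpherical.jacobiP_eq_tsum hr hp hm p k τ hh hn (ht p), hK, hG1, hG2, hG3,
        hG4 p hpL]
      ring
    · rw [hM]
      congr 1
      rw [Finset.mul_sum]
      refine Finset.sum_congr rfl fun p hpL => ?_
      have hpL := hle p hpL
      rw [LorentzSpherical.sphericalP_eq_regularized2F1 L i p hi hpL θ hc,
        LorentzSpherical.jacobiP_comm hr hp hm p k τ,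
        LorentzSpherical.jacobiP_eq_regularized2F1 hr hp hm k p τ hh (ht p) hn, hK, hG1, hG2,
        hG3, hG4 p hpL]
      rw [show (m : ℂ) - l₀ = i - L by rw [hmC, hl₀]; ring,
        show -(t p : ℂ) - l₀ = -p by rw [htC, hl₀]; ring,
        show (m : ℂ) - t p + 1 = i - p + 1 by rw [hmC, htC]; ring,
        show (t p : ℂ) - Complex.I * ρ + 1 / 2 = t p - (-1 / 2 + Complex.I * ρ) by ring,
        show -(n : ℂ) - Complex.I * ρ + 1 / 2 = -n - (-1 / 2 + Complex.I * ρ) by ring]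
      ring
    · rw [hM]
      congr 1
      rw [Finset.mul_sum]
      refine Finset.sum_congr rfl fun p hpL => ?_
      have hpL := hle p hpL
      rw [LorentzSpherical.sphericalP_comm L i p hi hpL θ hc,
        LorentzSpherical.sphericalP_eq_regularized2F1 L p i hpL hi θ hc,
        LorentzSpherical.jacobiP_eq_regularized2F1 hr hp hm p k τ hh hn (ht p), hK, hG1, hG2,
        hG3, hG4 p hpL]
      rw [show (t p : ℂ) - l₀ = p - L by rw [htC, hl₀]; ring,
        show -(m : ℂ) - l₀ = -i by rw [hmC, hl₀]; ring,
        show (t p : ℂ) - m + 1 = p - i + 1 by rw [hmC, htC]; ring,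
        show (n : ℂ) - Complex.I * ρ + 1 / 2 = n - (-1 / 2 + Complex.I * ρ) by ring,
        show -(t p : ℂ) - Complex.I * ρ + 1 / 2 = -t p - (-1 / 2 + Complex.I * ρ) by ring]
      ring
    · rw [hM]
      congr 1
      rw [Finset.mul_sum]
      refine Finset.sum_congr rfl fun p hpL => ?_
      have hpL := hle p hpL
      -- in each factor the two weights may be put into decreasing order
      have hP : LorentzSpherical.sphericalP L i p θ = C *
          (let A : ℝ := max m (t p)
             let B : ℝ := min m (t p)
             let a : ℕ := ((i : ℤ) - p).natAbs
             Complex.I ^ a / (Real.Gamma (a + 1) : ℂ)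
              * (Real.sqrt (Real.Gamma (l₀ + A + 1) * Real.Gamma (l₀ - B + 1)
                  / (Real.Gamma (l₀ - A + 1) * Real.Gamma (l₀ + B + 1))) : ℂ)
              * T ^ a
              * ordinaryHypergeometric ((A - l₀ : ℝ) : ℂ) ((-B - l₀ : ℝ) : ℂ)
                  ((A - B + 1 : ℝ) : ℂ) (-T ^ 2)) := by
        rcases le_total p i with hpi | hip
        · have hw : t p ≤ m := by simp only [t, m]; gcongr
          rw [max_eq_left hw, min_eq_right hw,
            show ((i : ℤ) - p).natAbs = i - p by omega,
            LorentzSpherical.sphericalP_eq_ordinaryHypergeometric L i p hi hpi θ hc]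
          dsimp only
          rw [hG1, hG2, hG3, hG4 p hpL, ← Complex.Gamma_ofReal]
          push_cast [T, C]
          rw [show (m : ℂ) - l₀ = i - L by rw [hmC, hl₀]; ring,
            show -(t p : ℂ) - l₀ = -p by rw [htC, hl₀]; ring,
            show (m : ℂ) - t p + 1 = i - p + 1 by rw [hmC, htC]; ring]
        · have hw : m ≤ t p := by simp only [t, m]; gcongr
          rw [max_eq_right hw, min_eq_left hw,
            show ((i : ℤ) - p).natAbs = p - i by omega,
            LorentzSpherical.sphericalP_comm L i p hi hpL θ hc,
            LorentzSpherical.sphericalP_eq_ordinaryHypergeometric L p i hpL hip θ hc]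
          dsimp only
          rw [hG1, hG2, hG3, hG4 p hpL, ← Complex.Gamma_ofReal]
          push_cast [T, C]
          rw [show (t p : ℂ) - l₀ = p - L by rw [htC, hl₀]; ring,
            show -(m : ℂ) - l₀ = -i by rw [hmC, hl₀]; ring,
            show (t p : ℂ) - m + 1 = p - i + 1 by rw [hmC, htC]; ring]
      have hJ : LorentzSpherical.jacobiP r (-1 / 2 + Complex.I * ρ) (-(L : ℤ)) p k τ = K *
          (let A : ℝ := max (t p) n
               let B : ℝ := min (t p) n
               let a : ℕ := ((p : ℤ) - k).natAbs
               (r (h + A) * r (h - B) / (r (h - A) * r (h + B))) / (Real.Gamma (a + 1) : ℂ)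
                * H ^ a
                * ordinaryHypergeometric (A - Complex.I * ρ + 1 / 2)
                    (-B - Complex.I * ρ + 1 / 2) ((A - B + 1 : ℝ) : ℂ) (H ^ 2)) := by
        rcases le_total k p with hkp | hpk
        · have hw : n ≤ t p := by
            simp only [t, n]; gcongr; exact_mod_cast hkp
          rw [max_eq_left hw, min_eq_right hw, LorentzSpherical.jacobiP_comm hr hp hm p k τ,
            LorentzSpherical.jacobiP_eq_ordinaryHypergeometric hr hp hm k p τ hh (ht p) hn
              (a := ((p : ℤ) - k).natAbs) (by omega), hK]
          dsimp only
          rw [← Complex.Gamma_ofReal]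
          push_cast [H]
          rw [show (t p : ℂ) - Complex.I * ρ + 1 / 2 = t p - (-1 / 2 + Complex.I * ρ) by ring,
            show -(n : ℂ) - Complex.I * ρ + 1 / 2 = -n - (-1 / 2 + Complex.I * ρ) by ring]
        · have hw : t p ≤ n := by
            simp only [t, n]; gcongr; exact_mod_cast hpk
          rw [max_eq_right hw, min_eq_left hw,
            LorentzSpherical.jacobiP_eq_ordinaryHypergeometric hr hp hm p k τ hh hn (ht p)
              (a := ((p : ℤ) - k).natAbs) (by omega), hK]
          dsimp only
          rw [← Complex.Gamma_ofReal]
          push_cast [H]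
          rw [show (n : ℂ) - Complex.I * ρ + 1 / 2 = n - (-1 / 2 + Complex.I * ρ) by ring,
            show -(t p : ℂ) - Complex.I * ρ + 1 / 2 = -t p - (-1 / 2 + Complex.I * ρ) by ring]
      rw [hP, hJ]
      ring
  · intro σ hσ
    have hp : ∀ j : ℤ, -1 / 2 - (σ : ℂ) + ((0 : ℤ) : ℂ) / 2 ≠ j := by
      intro j hj
      refine hσ (-j - 1) ?_
      have h1 : (σ : ℂ) = ((((-j - 1 : ℤ) : ℝ) + 1 / 2 : ℝ) : ℂ) := by
        push_cast at hj ⊢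
        linear_combination -hj
      exact_mod_cast h1
    have hm : ∀ j : ℤ, -1 / 2 - (σ : ℂ) - ((0 : ℤ) : ℂ) / 2 ≠ j := by
      intro j hj
      refine hp j ?_
      rw [← hj]
      simp
    have hl : -1 / 2 + Complex.I * (Complex.I * (σ : ℂ)) = -1 / 2 - σ := by
      linear_combination (σ : ℂ) * Complex.I_mul_I
    refine ⟨fun n => ⟨?_, ?_⟩, ?_⟩
    · have hre : ((θ : ℂ) - Complex.I * τ).re = θ := by simp
      have him : -((θ : ℂ) - Complex.I * τ).im = τ := by simp
      rw [LorentzSpherical.principalZ, hre, him, hl]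
      simp [LorentzSpherical.sphericalP_zero]
    · rw [LorentzSpherical.principalSpherical_eq, LorentzSpherical.supplementarySpherical_eq, hl]
      simp [LorentzSpherical.sphericalP_zero]
    · intro m n h H K E M
      have hh : h = -1 / 2 - (σ : ℂ) + 1 := by simp only [h]; ring
      have hK : (Real.cosh (τ / 2) : ℂ) ^ (2 * (-1 / 2 - (σ : ℂ))) = K := by
        simp only [K]; congr 1; ring
      have hw : ∀ a : ℤ, (a : ℂ) = a + ((0 : ℤ) : ℂ) / 2 := by intro a; simp
      have hfac : M = Complex.exp (-(m : ℂ) * (ε + Complex.I * φ))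
          * LorentzSpherical.jacobiP r (-1 / 2 - σ) 0 m n τ
          * Complex.exp (-(n : ℂ) * (ε' + Complex.I * ψ)) :=
        LorentzSpherical.supplementarySpherical_eq r σ m n φ ε θ τ ψ ε'
      have hM : M = E * LorentzSpherical.jacobiP r (-1 / 2 - σ) 0 m n τ := by
        have hE : E = Complex.exp (-(m : ℂ) * (ε + Complex.I * φ))
            * Complex.exp (-(n : ℂ) * (ε' + Complex.I * ψ)) := by
          simp only [E]
          rw [← Complex.exp_add]
          congr 1
          ring
        rw [hfac, hE]
        ring
      refine ⟨hfac, ?_, ?_, fun hnm => ?_, fun hmn => ?_⟩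
      · exact LorentzSpherical.summable_jacobiP_series hr hp hm m n τ hh (hw n) (hw m)
      · rw [hM, LorentzSpherical.jacobiP_eq_tsum hr hp hm m n τ hh (hw n) (hw m), hK]
      · obtain ⟨a, rfl⟩ : ∃ a : ℕ, m = n + a := ⟨(m - n).toNat, by omega⟩
        rw [hM, LorentzSpherical.jacobiP_comm hr hp hm,
          LorentzSpherical.jacobiP_eq_ordinaryHypergeometric hr hp hm n (n + a) τ hh (hw _) (hw n)
            rfl, hK, add_sub_cancel_left, zpow_natCast]
        rw [show ((n + a : ℤ) : ℂ) + σ + 1 / 2 = ((n + a : ℤ) : ℂ) - (-1 / 2 - σ) by ring,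
          show -(n : ℂ) + σ + 1 / 2 = -n - (-1 / 2 - σ) by ring,
          show Complex.Gamma (((n + a : ℤ) : ℂ) - n + 1) = Complex.Gamma (a + 1) by
            push_cast; ring_nf]
        ring
      · obtain ⟨a, rfl⟩ : ∃ a : ℕ, n = m + a := ⟨(n - m).toNat, by omega⟩
        rw [hM,
          LorentzSpherical.jacobiP_eq_ordinaryHypergeometric hr hp hm m (m + a) τ hh (hw _) (hw m)
            rfl, hK, add_sub_cancel_left, zpow_natCast]
        rw [show ((m + a : ℤ) : ℂ) + σ + 1 / 2 = ((m + a : ℤ) : ℂ) - (-1 / 2 - σ) by ring,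
          show -(m : ℂ) + σ + 1 / 2 = -m - (-1 / 2 - σ) by ring,
          show Complex.Gamma (((m + a : ℤ) : ℂ) - m + 1) = Complex.Gamma (a + 1) by
            push_cast; ring_nf]
        ring
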